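/- Let $\kappa<0$ and $\alpha>0$ be real constants, and let $H$ be an $m\times n$ matrix with i.i.d. standard normal entries, where $m=m_n$ is proportional to $n$ with ratio $\alpha$, i.e. $m_n/n\to\alpha$ as $n\to\infty$ (for instance $m=\alpha n$, rounded to an integer). For $c>0$ put $$\hat\gamma=\hat\gamma(c)=\frac{2c+\sqrt{4c^2+16}}{8},\qquad I_{sph}(c)=\hat\gamma-\frac{1}{2c}\log\Bigl(1-\frac{c}{2\hat\gamma}\Bigr).$$ For $c,\gamma>0$ put $$p=1+\frac{c}{2\gamma},\quad q=\frac{c\kappa}{2\gamma},\quad r=\frac{c\kappa^2}{4\gamma},\quad s=-\kappa\sqrt p+\frac{q}{\sqrt p},\quad C=\frac{\exp\bigl(\frac{q^2}{2p}-r\bigr)}{\sqrt p},$$ $$I^{(1)}_{per}(c,\gamma,\kappa)=\frac12\operatorname{erfc}\Bigl(\frac{\kappa}{\sqrt2}\Bigr)+\frac C2\operatorname{erfc}\Bigl(\frac{s}{\sqrt2}\Bigr),\qquad \operatorname{erfc}(x)=\frac{2}{\sqrt\pi}\int_x^\infty e^{-t^2}\,dt,$$ and $$I_{per}(c,\alpha,\kappa)=\sup_{\gamma>0}\Bigl(-\gamma+\frac{\alpha}{c}\log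 I^{(1)}_{per}(c,\gamma,\kappa)\Bigr).$$ If $$\inf_{c>0}\Bigl(-\frac c2+I_{sph}(c)+I_{per}(c,\alpha,\kappa)\Bigr)<0,$$ then with overwhelming probability there is no $x\in\mathbb R^n$ with $\|x\|_2=1$ and $(Hx)_i\ge\kappa$ for all $i=1,\dots,m$; that is, there is a constant $\delta>0$, independent of $n$, such that for all sufficiently large $n$ the probability that no such $x$ exists is at least $1-e^{-\delta n}$. -/

import Mathlib

open MeasureTheory ProbabilityTheory Filter Topology

noncomputable section

namespace NegPerceptron

/-- The complementary error function `erfc x = (2 / √π) ∫_x^∞ exp (-t²) dt`. -/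
def erfc (x : ℝ) : ℝ := 2 / √Real.pi * ∫ t in Set.Ioi x, Real.exp (-t ^ 2)

/-- The optimal spherical parameter `γ̂` as a function of the lifting parameter `c`. -/
def gammaHat (c : ℝ) : ℝ := (2 * c + √(4 * c ^ 2 + 16)) / 8

/-- The spherical term `I_sph(c)`, for `c > 0`. -/
def Isph (c : ℝ) : ℝ :=
  gammaHat c - 1 / (2 * c) * Real.log (1 - c / (2 * gammaHat c))

/-- The quantity `I_per^(1)(c, γ, κ)`, for `c, γ > 0`, in its closed `erfc` form. -/
def Iper1 (c γ κ : ℝ) : ℝ :=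
  let p : ℝ := 1 + c / (2 * γ)
  let q : ℝ := c * κ / (2 * γ)
  let r : ℝ := c * κ ^ 2 / (4 * γ)
  let s : ℝ := -κ * √p + q / √p
  let C : ℝ := Real.exp (q ^ 2 / (2 * p) - r) / √p
  1 / 2 * erfc (κ / √2) + C / 2 * erfc (s / √2)

/-- The perceptron term `I_per(c, α, κ)`, for `c > 0`: the supremum over `γ > 0` of
`-γ + (α / c) log I_per^(1)(c, γ, κ)`. It is taken in the extended reals, so that no junk value
of a supremum can occur. -/
def Iper (c α κ : ℝ) : EReal :=
  ⨆ γ : Set.Ioi (0 : ℝ), ((-(γ : ℝ) + α / c * Real.log (Iper1 c γ κ) : ℝ) : EReal)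

/-- The infimum over the lifting parameter `c > 0` of `-c / 2 + I_sph(c) + I_per(c, α, κ)`,
in the extended reals. -/
def liftedValue (α κ : ℝ) : EReal :=
  ⨅ c : Set.Ioi (0 : ℝ), (((-(c : ℝ) / 2 + Isph c : ℝ) : EReal) + Iper c α κ)

/-- The random `m × n` matrix `H` has i.i.d. standard normal entries under `P`. -/
structure IsStdGaussianMatrix {m n : ℕ} {Ω : Type*} [MeasurableSpace Ω]
    (H : Ω → Matrix (Fin m) (Fin n) ℝ) (P : Measure Ω) : Prop where
  hasLaw : ∀ i j, HasLaw (fun ω => H ω i j) (gaussianReal 0 1) P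
  indep : iIndepFun (fun (ij : Fin m × Fin n) ω => H ω ij.1 ij.2) P

/-- The spherical perceptron problem: there is a vector `x` of Euclidean norm one all of whose
inner products with the rows of `A` are at least `κ`. -/
def Feasible {m n : ℕ} (A : Matrix (Fin m) (Fin n) ℝ) (κ : ℝ) : Prop :=
  ∃ x : EuclideanSpace ℝ (Fin n), ‖x‖ = 1 ∧ ∀ i, κ ≤ (A.mulVec x.ofLp) i

end NegPerceptron

end

/-!
The proof is Gordon's Gaussian comparison in its lifted (exponential) form, followed by a Chernoff
bound.

Let `f y = -√(ε² + ∑ i, (κ - y i)₊²)`, a continuously differentiable `1`-Lipschitz function which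
equals `-ε` exactly when `κ ≤ y i` for all `i`. For a standard Gaussian matrix `H`, Gaussian vectors `g`, `h` and a
Gaussian scalar `g₀`, all independent, the families `x ↦ (g₀, H x)` and `x ↦ (⟨h, x⟩, g)` over unit
vectors `x` have the same law for each single `x`. For `x ≠ x'` the covariance of the scalar
components is larger by `1 - ⟨x, x'⟩` in the first family, and that of each vector component is
smaller by the same amount. For finitely many `x`, the two families are joined by a rotation and the
expectation of `(∑ x, exp (lam * (s x + f (y x)))) ^ p` is differentiated along it. Gaussian
integration by parts turns the derivative into a sum over pairs `x, x'` of the factor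
`p * (p - 1) * (1 - ⟨x, x'⟩)` times `1 - ⟨∇f (y x), ∇f (y x')⟩ ≥ 0` times a positive quantity
(`integral_expSum_rpow_le`). For `0 < p ≤ 1` the expectation is therefore largest for the decoupled
family. With `lam = C / p` and `p → 0` the functional becomes the maximum over `x` of
`exp (C * (s x + f (y x)))`, which yields (`measure_feasible_le`, after exhausting the sphere by
finite sets)

  `exp (C² / 2) * 𝔼 max_x exp (C * f (H x)) ≤ 𝔼 exp (C * ‖h‖) * 𝔼 exp (C * f g)`.

The derivative of `f` is only taken to first order: the velocity of the rotation at `x` is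
orthogonal to the position at `x`, so that the factors depending on `x` alone are constant in the
direction of the integration by parts.

With `C = c √n` the right-hand side is computed by linearizing the norms through
`√n * R ≤ γ * n + R² / (4 * γ)`. The first factor is at most `exp (n c Isph)`
(`integral_exp_mul_norm_le`). In the second factor the best `γ` depends on `g`, and is restricted to
a finite grid (`exp_neg_mul_le_grid`); each grid point contributes the power `m` of a
one-dimensional Gaussian integral with value `Iper1` (`integral_exp_neg_max_sq_gaussianReal`), so
that the factor is `exp (n c Iper)` up to an arbitrarily small exponential rate.
-/

namespace NegPerceptron

/-! ### The standard Gaussian measure and integration by parts -/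

/-- The standard Gaussian measure on `ι → ℝ`. -/
noncomputable def stdGauss (ι : Type*) [Fintype ι] : Measure (ι → ℝ) :=
  Measure.pi fun _ => gaussianReal 0 1

/-- The density of `stdGauss ι` with respect to Lebesgue measure. -/
noncomputable def stdGaussPDF {ι : Type*} [Fintype ι] (w : ι → ℝ) : ℝ :=
  ∏ i, gaussianPDFReal 0 1 (w i)

section Gauss

variable {ι : Type*} [Fintype ι]

instance : IsProbabilityMeasure (stdGauss ι) := by unfold stdGauss; infer_instance

lemma stdGaussPDF_nonneg (w : ι → ℝ) : 0 ≤ stdGaussPDF w :=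
  Finset.prod_nonneg fun _ _ => gaussianPDFReal_nonneg _ _ _

lemma measurable_stdGaussPDF : Measurable (stdGaussPDF : (ι → ℝ) → ℝ) :=
  Finset.measurable_prod _ fun i _ => (measurable_gaussianPDFReal 0 1).comp (measurable_pi_apply i)

lemma stdGauss_eq_withDensity :
    stdGauss ι = (volume : Measure (ι → ℝ)).withDensity fun w => ENNReal.ofReal (stdGaussPDF w) := by
  unfold stdGauss
  refine Measure.pi_eq fun s hs => ?_
  have hbox : MeasurableSet (Set.univ.pi s) := MeasurableSet.univ_pi hs
  have key : ∀ w : ι → ℝ, (Set.univ.pi s).indicator (fun w => stdGaussPDF w) w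
      = ∏ i, (s i).indicator (gaussianPDFReal 0 1) (w i) := by
    intro w
    by_cases hw : w ∈ Set.univ.pi s
    · rw [Set.indicator_of_mem hw, stdGaussPDF]
      exact Finset.prod_congr rfl fun i _ => by rw [Set.indicator_of_mem (hw i trivial)]
    · rw [Set.indicator_of_notMem hw]
      simp only [Set.mem_pi, Set.mem_univ, true_imp_iff, not_forall] at hw
      obtain ⟨i, hi⟩ := hw
      exact (Finset.prod_eq_zero (Finset.mem_univ i) (Set.indicator_of_notMem hi _)).symm
  have hint : ∀ i, Integrable ((s i).indicator (gaussianPDFReal 0 1)) :=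
    fun i => (integrable_gaussianPDFReal 0 1).indicator (hs i)
  rw [withDensity_apply _ hbox, ← lintegral_indicator hbox]
  have h1 : ∀ w : ι → ℝ,
      (Set.univ.pi s).indicator (fun w => ENNReal.ofReal (stdGaussPDF w)) w
      = ENNReal.ofReal (∏ i, (s i).indicator (gaussianPDFReal 0 1) (w i)) := by
    intro w
    rw [← key]
    by_cases hw : w ∈ Set.univ.pi s <;> simp [hw]
  simp_rw [h1]
  rw [← ofReal_integral_eq_lintegral_ofReal]
  · rw [integral_fintype_prod_volume_eq_prod (f := fun i => (s i).indicator (gaussianPDFReal 0 1)),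
      ENNReal.ofReal_prod_of_nonneg]
    · refine Finset.prod_congr rfl fun i _ => ?_
      rw [gaussianReal_apply_eq_integral _ one_ne_zero, integral_indicator (hs i)]
    · intro i _
      exact integral_nonneg fun x => Set.indicator_nonneg (fun _ _ => gaussianPDFReal_nonneg _ _ _) _
  · exact Integrable.fintype_prod (f := fun i => (s i).indicator (gaussianPDFReal 0 1)) hint
  · exact ae_of_all _ fun w => Finset.prod_nonneg fun i _ =>
      Set.indicator_nonneg (fun _ _ => gaussianPDFReal_nonneg _ _ _) _

lemma integral_stdGauss (Q : (ι → ℝ) → ℝ) :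
    ∫ w, Q w ∂(stdGauss ι) = ∫ w, Q w * stdGaussPDF w := by
  rw [stdGauss_eq_withDensity, integral_withDensity_eq_integral_toReal_smul
    measurable_stdGaussPDF.ennreal_ofReal (ae_of_all _ fun _ => ENNReal.ofReal_lt_top)]
  refine integral_congr_ae (ae_of_all _ fun w => ?_)
  simp [ENNReal.toReal_ofReal (stdGaussPDF_nonneg w), mul_comm]

lemma integrable_stdGauss_iff (Q : (ι → ℝ) → ℝ) :
    Integrable Q (stdGauss ι) ↔ Integrable (fun w => Q w * stdGaussPDF w) := by
  rw [stdGauss_eq_withDensity, integrable_withDensity_iff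
    measurable_stdGaussPDF.ennreal_ofReal (ae_of_all _ fun _ => ENNReal.ofReal_lt_top)]
  simp [ENNReal.toReal_ofReal (stdGaussPDF_nonneg _)]

lemma hasLineDerivAt_stdGaussPDF (w v : ι → ℝ) :
    HasLineDerivAt ℝ (stdGaussPDF : (ι → ℝ) → ℝ) (-(v ⬝ᵥ w) * stdGaussPDF w) w v := by
  have hexp : (stdGaussPDF : (ι → ℝ) → ℝ)
      = fun w => (√(2 * Real.pi))⁻¹ ^ (Fintype.card ι) * Real.exp (∑ i, -(w i) ^ 2 / 2) := by
    funext w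
    simp [stdGaussPDF, gaussianPDFReal, Finset.prod_mul_distrib, Real.exp_sum]
  rw [hexp]
  unfold HasLineDerivAt
  have h1 : ∀ i, HasDerivAt (fun t : ℝ => -((w + t • v) i) ^ 2 / 2) (-(v i * w i)) 0 := by
    intro i
    have : HasDerivAt (fun t : ℝ => w i + t * v i) (v i) 0 := by
      simpa using ((hasDerivAt_id (0 : ℝ)).mul_const (v i)).const_add (w i)
    have h2 := ((this.pow 2).neg).div_const 2
    convert! h2 using 1
    simp; ring
  have h2 := (HasDerivAt.fun_sum (u := Finset.univ) fun i _ => h1 i).exp.const_mul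
    ((√(2 * Real.pi))⁻¹ ^ (Fintype.card ι))
  convert! h2 using 1
  simp [dotProduct]
  ring

/-- **Gaussian integration by parts** in the direction `v`. Only a derivative along `v` is needed. -/
theorem integral_dotProduct_mul_stdGauss {v : ι → ℝ} {Q D : (ι → ℝ) → ℝ}
    (hQ : Integrable Q (stdGauss ι)) (hD : Integrable D (stdGauss ι))
    (hvQ : Integrable (fun w => (v ⬝ᵥ w) * Q w) (stdGauss ι))
    (hd : ∀ w, HasLineDerivAt ℝ Q (D w) w v) :
    ∫ w, (v ⬝ᵥ w) * Q w ∂(stdGauss ι) = ∫ w, D w ∂(stdGauss ι) := by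
  rw [integrable_stdGauss_iff] at hQ hD hvQ
  have h := integral_bilinear_hasLineDerivAt_right_eq_neg_left_of_integrable
    (μ := (volume : Measure (ι → ℝ))) (f := Q) (f' := D) (g := stdGaussPDF)
    (g' := fun w => -(v ⬝ᵥ w) * stdGaussPDF w) (v := v) (B := ContinuousLinearMap.mul ℝ ℝ)
    (by simpa using hD)
    (by
      refine hvQ.neg.congr (ae_of_all _ fun w => ?_)
      simp; ring)
    (by simpa using hQ) (fun w _ => hd w) (fun w _ => hasLineDerivAt_stdGaussPDF w v)
  rw [integral_stdGauss, integral_stdGauss]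
  simp only [ContinuousLinearMap.mul_apply'] at h
  rw [← neg_eq_iff_eq_neg, ← integral_neg] at h
  rw [← h]
  congr 1
  funext w
  ring

lemma integrable_exp_abs_gaussianReal (B : ℝ) :
    Integrable (fun x : ℝ => Real.exp (B * |x|)) (gaussianReal 0 1) := by
  refine ((integrable_exp_mul_gaussianReal B).add (integrable_exp_mul_gaussianReal (-B))).mono'
    (by fun_prop) (ae_of_all _ fun x => ?_)
  rw [Real.norm_eq_abs, abs_of_pos (Real.exp_pos _)]
  rcases abs_cases x with ⟨h, _⟩ | ⟨h, _⟩ <;> rw [h]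
  · simp [(Real.exp_pos _).le]
  · simp [(Real.exp_pos _).le]

lemma integrable_exp_sum_abs_stdGauss (B : ℝ) :
    Integrable (fun w : ι → ℝ => Real.exp (B * ∑ i, |w i|)) (stdGauss ι) := by
  simp_rw [Finset.mul_sum, Real.exp_sum]
  exact Integrable.fintype_prod (f := fun _ x => Real.exp (B * |x|))
    fun _ => integrable_exp_abs_gaussianReal B

/-- Continuous functions of at most exponential growth are integrable for the Gaussian measure. -/
lemma integrable_stdGauss_of_le_exp {Q : (ι → ℝ) → ℝ} (hc : Continuous Q) {C B : ℝ}
    (hb : ∀ w, |Q w| ≤ C * Real.exp (B * ∑ i, |w i|)) : Integrable Q (stdGauss ι) :=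
  ((integrable_exp_sum_abs_stdGauss B).const_mul C).mono' hc.aestronglyMeasurable
    (ae_of_all _ hb)

end Gauss

section Product

variable {α β : Type*} [Fintype α] [Fintype β]

lemma integral_mul_stdGauss_sum (φ : (α → ℝ) → ℝ) (ψ : (β → ℝ) → ℝ) :
    ∫ w, φ (fun a => w (Sum.inl a)) * ψ (fun b => w (Sum.inr b)) ∂(stdGauss (α ⊕ β)) =
      (∫ u, φ u ∂(stdGauss α)) * ∫ v, ψ v ∂(stdGauss β) := by
  have h := measurePreserving_sumPiEquivProdPi (ι := α) (ι' := β) (X := fun _ => ℝ)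
    (fun _ => gaussianReal 0 1)
  rw [← integral_prod_mul]
  exact h.integral_comp (MeasurableEquiv.measurableEmbedding _)
    (fun q : (α → ℝ) × (β → ℝ) => φ q.1 * ψ q.2)

end Product

/-! ### Gaussian comparison for exponential sums -/

section Comparison

variable {ι T A : Type*} [Fintype ι] [Fintype T]

/-- The exponential sum `∑ x, exp (lam * h (ζ x))` over a finite family of points `ζ x : A → ℝ`. -/
noncomputable def expSum (h : (A → ℝ) → ℝ) (lam : ℝ) (ζ : T → A → ℝ) : ℝ :=
  ∑ x, Real.exp (lam * h (ζ x))

lemma expSum_pos [Nonempty T] (h : (A → ℝ) → ℝ) (lam : ℝ) (ζ : T → A → ℝ) :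
    0 < expSum h lam ζ :=
  Finset.sum_pos (fun _ _ => Real.exp_pos _) Finset.univ_nonempty

lemma exp_le_expSum (h : (A → ℝ) → ℝ) (lam : ℝ) (ζ : T → A → ℝ) (x : T) :
    Real.exp (lam * h (ζ x)) ≤ expSum h lam ζ :=
  Finset.single_le_sum (f := fun x => Real.exp (lam * h (ζ x)))
    (fun _ _ => (Real.exp_pos _).le) (Finset.mem_univ x)

lemma abs_dotProduct_le_sum_mul_sum (u w : ι → ℝ) :
    |u ⬝ᵥ w| ≤ (∑ k, |u k|) * ∑ k, |w k| := by
  rw [Finset.sum_mul]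
  refine (Finset.abs_sum_le_sum_abs _ _).trans (Finset.sum_le_sum fun k _ => ?_)
  rw [abs_mul]
  exact mul_le_mul_of_nonneg_left
    (Finset.single_le_sum (f := fun k => |w k|) (fun _ _ => abs_nonneg _) (Finset.mem_univ k))
    (abs_nonneg _)

/-- A weighted sum of the summands of `expSum` is at most the largest weight times `expSum`. -/
lemma abs_sum_mul_exp_le (h : (A → ℝ) → ℝ) (lam : ℝ) (ζ : T → A → ℝ) (c : T → ℝ) {M : ℝ}
    (hc : ∀ x, |c x| ≤ M) :
    |∑ x, Real.exp (lam * h (ζ x)) * c x| ≤ expSum h lam ζ * M := by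
  rw [expSum, Finset.sum_mul]
  refine (Finset.abs_sum_le_sum_abs _ _).trans (Finset.sum_le_sum fun x _ => ?_)
  rw [abs_mul, abs_of_pos (Real.exp_pos _)]
  exact mul_le_mul_of_nonneg_left (hc x) (Real.exp_pos _).le

variable [Fintype A] {h : (A → ℝ) → ℝ} {g : (A → ℝ) → A → ℝ}

lemma expSum_rpow_le [Nonempty T] (hgrowth : ∀ z, h z ≤ ∑ a, |z a|) {lam p L S : ℝ}
    (hlam : 0 < lam) (hp : 0 < p) {ζ : T → A → ℝ} (hζ : ∀ x a, |ζ x a| ≤ L * S) :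
    expSum h lam ζ ^ p ≤ (Fintype.card T : ℝ) ^ p *
      Real.exp (p * (lam * (Fintype.card A * L)) * S) := by
  have h1 : expSum h lam ζ ≤ Fintype.card T * Real.exp (lam * (Fintype.card A * L) * S) := by
    have : ∀ x ∈ (Finset.univ : Finset T),
        Real.exp (lam * h (ζ x)) ≤ Real.exp (lam * (Fintype.card A * L) * S) := by
      intro x _
      refine Real.exp_le_exp.2 ?_
      have : h (ζ x) ≤ Fintype.card A * L * S := by
        refine (hgrowth _).trans ((Finset.sum_le_sum fun a _ => hζ x a).trans_eq ?_)
        simp [mul_assoc]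
      nlinarith
    simpa [expSum] using Finset.sum_le_sum this
  calc expSum h lam ζ ^ p
      ≤ (Fintype.card T * Real.exp (lam * (Fintype.card A * L) * S)) ^ p :=
        Real.rpow_le_rpow (expSum_pos _ _ _).le h1 hp.le
    _ = _ := by
        rw [Real.mul_rpow (by positivity) (Real.exp_pos _).le, ← Real.exp_mul]
        congr 2
        ring

lemma integrable_expSum_rpow [Nonempty T] (hcont : Continuous h)
    (hgrowth : ∀ z, h z ≤ ∑ a, |z a|) (U : T → A → ι → ℝ) {lam p : ℝ}
    (hlam : 0 < lam) (hp : 0 < p) :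
    Integrable (fun w => expSum h lam (fun x a => U x a ⬝ᵥ w) ^ p) (stdGauss ι) := by
  refine integrable_stdGauss_of_le_exp (C := (Fintype.card T : ℝ) ^ p)
    (B := p * (lam * (Fintype.card A * ∑ x, ∑ a, ∑ k, |U x a k|))) ?_ fun w => ?_
  · refine (continuous_finsetSum _ fun x _ => Real.continuous_exp.comp (continuous_const.mul
      (hcont.comp (continuous_pi fun a => ?_)))).rpow_const
        fun w => Or.inl (expSum_pos h lam _).ne'
    simp only [dotProduct]; fun_prop
  · rw [abs_of_pos (Real.rpow_pos_of_pos (expSum_pos _ _ _) _)]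
    refine expSum_rpow_le hgrowth hlam hp fun x a => ?_
    refine (abs_dotProduct_le_sum_mul_sum _ _).trans
      (mul_le_mul_of_nonneg_right ?_ (by positivity))
    refine le_trans ?_ (Finset.single_le_sum (f := fun x => ∑ a, ∑ k, |U x a k|)
      (fun _ _ => by positivity) (Finset.mem_univ x))
    exact Finset.single_le_sum (f := fun a => ∑ k, |U x a k|)
      (fun _ _ => by positivity) (Finset.mem_univ a)

lemma hasDerivAt_expSum_rpow [Nonempty T]
    (hh : ∀ z, HasFDerivAt h
      (∑ a, g z a • (ContinuousLinearMap.proj a : (A → ℝ) →L[ℝ] ℝ)) z)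
    (lam r : ℝ) {ζ : ℝ → T → A → ℝ} {ζ' : T → A → ℝ} {t : ℝ}
    (hζ : ∀ x a, HasDerivAt (fun t => ζ t x a) (ζ' x a) t) :
    HasDerivAt (fun t => expSum h lam (ζ t) ^ r)
      (r * expSum h lam (ζ t) ^ (r - 1) *
        (lam * ∑ x, Real.exp (lam * h (ζ t x)) * ∑ a, g (ζ t x) a * ζ' x a)) t := by
  have h1 : ∀ x, HasDerivAt (fun t => Real.exp (lam * h (ζ t x)))
      (Real.exp (lam * h (ζ t x)) * (lam * ∑ a, g (ζ t x) a * ζ' x a)) t := by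
    intro x
    have hz : HasDerivAt (fun t => ζ t x) (ζ' x) t := hasDerivAt_pi.2 (hζ x)
    have := (hh (ζ t x)).comp_hasDerivAt t hz
    simp only [sum_apply, smul_apply,
      ContinuousLinearMap.proj_apply, smul_eq_mul] at this
    exact (this.const_mul lam).exp
  have h2 := (HasDerivAt.fun_sum (u := Finset.univ) fun x _ => h1 x).rpow_const (p := r)
    (Or.inl (expSum_pos h lam (ζ t)).ne')
  convert! h2 using 1
  simp only [expSum, Finset.mul_sum, Finset.sum_mul]
  refine Finset.sum_congr rfl fun x _ => Finset.sum_congr rfl fun a _ => ?_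
  ring

/-- **Gaussian comparison in Gordon's form.** Two centred Gaussian families `(X x a)` and `(Y x a)`
with the same covariances along each single `x` are compared through the concave power
`(∑ x, exp (lam * h (· x))) ^ p`. Only the covariances between different indices `x` matter, and
these enter with the sign of `p * (p - 1)`. The vectors `X x a`, `Y x a` are the coefficients
of the families as linear forms in a standard Gaussian vector; orthogonality of
the `X x a` to the `Y x' b` makes the two families independent. -/
theorem integral_expSum_rpow_le [Nonempty T]
    (hh : ∀ z, HasFDerivAt h
      (∑ a, g z a • (ContinuousLinearMap.proj a : (A → ℝ) →L[ℝ] ℝ)) z)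
    (hg : ∀ a, Continuous fun z => g z a) (hg1 : ∀ z a, |g z a| ≤ 1)
    (hgrowth : ∀ z, h z ≤ ∑ a, |z a|)
    {X Y : T → A → ι → ℝ} (hXY : ∀ x a x' b, X x a ⬝ᵥ Y x' b = 0)
    (hdiag : ∀ x a b, X x a ⬝ᵥ X x b = Y x a ⬝ᵥ Y x b)
    (hcross : ∀ x x' z z',
      0 ≤ ∑ a, ∑ b, g z a * g z' b * (X x a ⬝ᵥ X x' b - Y x a ⬝ᵥ Y x' b))
    {lam p : ℝ} (hlam : 0 < lam) (hp : 0 < p) (hp1 : p ≤ 1) :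
    ∫ w, expSum h lam (fun x a => X x a ⬝ᵥ w) ^ p ∂(stdGauss ι) ≤
      ∫ w, expSum h lam (fun x a => Y x a ⬝ᵥ w) ^ p ∂(stdGauss ι) := by
  -- The rotation `Z θ` joins `Y` (at `θ = 0`) to `X` (at `θ = π / 2`); `Z'` is its velocity.
  set Z : ℝ → T → A → ι → ℝ := fun θ x a => Real.sin θ • X x a + Real.cos θ • Y x a with hZ
  set Z' : ℝ → T → A → ι → ℝ := fun θ x a => Real.cos θ • X x a - Real.sin θ • Y x a with hZ'
  set z : ℝ → (ι → ℝ) → T → A → ℝ := fun θ w x a => Z θ x a ⬝ᵥ w with hz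
  have hcont : Continuous h := continuous_iff_continuousAt.2 fun z => (hh z).continuousAt
  have hdc : ∀ u : ι → ℝ, Continuous fun w => u ⬝ᵥ w := fun u => by
    simp only [dotProduct]; fun_prop
  have hzc : ∀ θ x, Continuous fun w => z θ w x := fun θ x =>
    continuous_pi fun a => hdc (Z θ x a)
  have hec : ∀ θ x, Continuous fun w => Real.exp (lam * h (z θ w x)) := fun θ x =>
    Real.continuous_exp.comp (continuous_const.mul (hcont.comp (hzc θ x)))
  have hGc : ∀ θ, Continuous fun w => expSum h lam (z θ w) := fun θ =>
    continuous_finsetSum _ fun x _ => hec θ x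
  have hGpos : ∀ θ w, 0 < expSum h lam (z θ w) := fun θ w => expSum_pos _ _ _
  have hGr : ∀ θ (r : ℝ), Continuous fun w => expSum h lam (z θ w) ^ r := fun θ r =>
    (hGc θ).rpow_const fun w => Or.inl (hGpos θ w).ne'
  have hgc : ∀ θ x a, Continuous fun w => g (z θ w x) a := fun θ x a => (hg a).comp (hzc θ x)
  -- uniform linear growth of the two families
  obtain ⟨L, hL0, hL, hL'⟩ : ∃ L : ℝ, 0 ≤ L ∧
      (∀ θ x a w, |Z θ x a ⬝ᵥ w| ≤ L * ∑ k, |w k|) ∧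
      (∀ θ x a w, |Z' θ x a ⬝ᵥ w| ≤ L * ∑ k, |w k|) := by
    have hsum : ∀ x a, ∑ k, (|X x a k| + |Y x a k|) ≤
        ∑ x, ∑ a, ∑ k, (|X x a k| + |Y x a k|) := by
      intro x a
      refine le_trans ?_ (Finset.single_le_sum (f := fun x => ∑ a, ∑ k, (|X x a k| + |Y x a k|))
        (fun _ _ => by positivity) (Finset.mem_univ x))
      exact Finset.single_le_sum (f := fun a => ∑ k, (|X x a k| + |Y x a k|))
        (fun _ _ => by positivity) (Finset.mem_univ a)
    have hcs : ∀ (s c a b : ℝ), |s| ≤ 1 → |c| ≤ 1 → |s * a| + |c * b| ≤ |a| + |b| := by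
      intro s c a b hs hc
      rw [abs_mul, abs_mul]
      nlinarith [abs_nonneg a, abs_nonneg b]
    refine ⟨∑ x, ∑ a, ∑ k, (|X x a k| + |Y x a k|), by positivity, fun θ x a w => ?_,
      fun θ x a w => ?_⟩
    · refine (abs_dotProduct_le_sum_mul_sum _ _).trans
        (mul_le_mul_of_nonneg_right (le_trans (Finset.sum_le_sum fun k _ => ?_) (hsum x a))
          (by positivity))
      simp only [hZ, Pi.add_apply, Pi.smul_apply, smul_eq_mul]
      exact (abs_add_le _ _).trans
        (hcs _ _ _ _ (Real.abs_sin_le_one θ) (Real.abs_cos_le_one θ))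
    · refine (abs_dotProduct_le_sum_mul_sum _ _).trans
        (mul_le_mul_of_nonneg_right (le_trans (Finset.sum_le_sum fun k _ => ?_) (hsum x a))
          (by positivity))
      simp only [hZ', Pi.sub_apply, Pi.smul_apply, smul_eq_mul]
      exact (abs_sub _ _).trans
        (hcs _ _ _ _ (Real.abs_cos_le_one θ) (Real.abs_sin_le_one θ))
  set S : (ι → ℝ) → ℝ := fun w => ∑ k, |w k| with hS
  have hS0 : ∀ w, 0 ≤ S w := fun w => by positivity
  set cA : ℝ := (Fintype.card A : ℝ) with hcA
  set cT : ℝ := (Fintype.card T : ℝ) with hcT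
  set B : ℝ := p * (lam * (cA * L)) with hB
  have hG_le : ∀ θ w, expSum h lam (z θ w) ^ p ≤ cT ^ p * Real.exp (B * S w) := by
    exact fun θ w => expSum_rpow_le hgrowth hlam hp fun x a => hL θ x a w
  have hG_int : ∀ θ, Integrable (fun w => expSum h lam (z θ w) ^ p) (stdGauss ι) := fun θ =>
    integrable_expSum_rpow hcont hgrowth (Z θ) hlam hp
  have hpow1 : ∀ θ w, expSum h lam (z θ w) ^ (p - 1) * expSum h lam (z θ w)
      = expSum h lam (z θ w) ^ p := fun θ w => by
    rw [← Real.rpow_add_one (hGpos θ w).ne', sub_add_cancel]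
  have hpow2 : ∀ θ w, expSum h lam (z θ w) ^ (p - 1 - 1) * expSum h lam (z θ w)
      = expSum h lam (z θ w) ^ (p - 1) := fun θ w => by
    rw [← Real.rpow_add_one (hGpos θ w).ne', sub_add_cancel]
  have hSexp : ∀ w, S w * Real.exp (B * S w) ≤ Real.exp ((B + 1) * S w) := fun w => by
    rw [add_mul, one_mul, Real.exp_add, mul_comm]
    exact mul_le_mul_of_nonneg_left ((by linarith [Real.add_one_le_exp (S w)] :
      S w ≤ Real.exp (S w))) (Real.exp_pos _).le
  -- the `θ`-derivative of the integrand
  set F' : ℝ → (ι → ℝ) → ℝ := fun θ w => p * expSum h lam (z θ w) ^ (p - 1) *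
    (lam * ∑ x, Real.exp (lam * h (z θ w x)) * ∑ a, g (z θ w x) a * (Z' θ x a ⬝ᵥ w)) with hF'
  have hderiv : ∀ w θ, HasDerivAt (fun θ => expSum h lam (z θ w) ^ p) (F' θ w) θ := by
    intro w θ
    refine hasDerivAt_expSum_rpow hh lam p (ζ := fun θ => z θ w)
      (ζ' := fun x a => Z' θ x a ⬝ᵥ w) fun x a => ?_
    simp only [hz, hZ, hZ', add_dotProduct, smul_dotProduct, sub_dotProduct, smul_eq_mul]
    convert! ((Real.hasDerivAt_sin θ).mul_const (X x a ⬝ᵥ w)).add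
      ((Real.hasDerivAt_cos θ).mul_const (Y x a ⬝ᵥ w)) using 1
    ring
  have hF'_le : ∀ θ w, |F' θ w| ≤
      p * lam * (cA * L) * cT ^ p * Real.exp ((B + 1) * S w) := by
    intro θ w
    have h1 := abs_sum_mul_exp_le h lam (z θ w)
      (fun x => ∑ a, g (z θ w x) a * (Z' θ x a ⬝ᵥ w)) (M := cA * L * S w) fun x => by
        refine (Finset.abs_sum_le_sum_abs _ _).trans ?_
        refine (Finset.sum_le_sum (g := fun _ => L * S w) fun a _ => ?_).trans_eq ?_
        · rw [abs_mul]
          nlinarith [hg1 (z θ w x) a, hL' θ x a w, abs_nonneg (g (z θ w x) a),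
            abs_nonneg (Z' θ x a ⬝ᵥ w)]
        · simp [hcA, mul_assoc]
    have hpos := Real.rpow_pos_of_pos (hGpos θ w) (p - 1)
    calc |F' θ w| = p * lam * expSum h lam (z θ w) ^ (p - 1) *
          |∑ x, Real.exp (lam * h (z θ w x)) * ∑ a, g (z θ w x) a * (Z' θ x a ⬝ᵥ w)| := by
          simp only [hF']
          rw [abs_mul, abs_mul, abs_mul, abs_of_pos hp, abs_of_pos hpos, abs_of_pos hlam]
          ring
      _ ≤ p * lam * expSum h lam (z θ w) ^ (p - 1) *
          (expSum h lam (z θ w) * (cA * L * S w)) := by gcongr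
      _ = p * lam * (cA * L) * S w * expSum h lam (z θ w) ^ p := by rw [← hpow1]; ring
      _ ≤ p * lam * (cA * L) * S w * (cT ^ p * Real.exp (B * S w)) := by
          have := hS0 w
          have hc0 : 0 ≤ cA := by positivity
          gcongr
          exact hG_le θ w
      _ = p * lam * (cA * L) * cT ^ p * (S w * Real.exp (B * S w)) := by ring
      _ ≤ _ := by
          have hc0 : 0 ≤ cA := by positivity
          gcongr
          exact hSexp w
  have hJ : ∀ θ, HasDerivAt (fun θ => ∫ w, expSum h lam (z θ w) ^ p ∂(stdGauss ι))
      (∫ w, F' θ w ∂(stdGauss ι)) θ := by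
    intro θ
    refine (hasDerivAt_integral_of_dominated_loc_of_deriv_le (s := Set.univ) (F' := F')
      (bound := fun w => p * lam * (cA * L) * cT ^ p * Real.exp ((B + 1) * S w))
      univ_mem (Eventually.of_forall fun θ => (hGr θ p).aestronglyMeasurable) (hG_int θ) ?_
      (ae_of_all _ fun w θ _ => hF'_le θ w)
      ((integrable_exp_sum_abs_stdGauss (B + 1)).const_mul _)
      (ae_of_all _ fun w θ _ => hderiv w θ)).2
    refine Continuous.aestronglyMeasurable ?_
    refine ((continuous_const.mul (hGr θ _))).mul (continuous_const.mul
      (continuous_finsetSum _ fun x _ => (hec θ x).mul (continuous_finsetSum _ fun a _ =>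
        (hgc θ x a).mul (hdc _))))
  -- integration by parts: the velocity `Z' θ x a` is orthogonal to `Z θ x b`
  have hZZ' : ∀ θ x a x' b, Z θ x' b ⬝ᵥ Z' θ x a =
      Real.sin θ * Real.cos θ * (X x a ⬝ᵥ X x' b - Y x a ⬝ᵥ Y x' b) := by
    intro θ x a x' b
    simp only [hZ, hZ', add_dotProduct, dotProduct_sub, smul_dotProduct, dotProduct_smul,
      smul_eq_mul]
    rw [hXY, dotProduct_comm (Y x' b) (X x a), hXY, dotProduct_comm (X x' b) (X x a),
      dotProduct_comm (Y x' b) (Y x a)]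
    ring
  set Q : ℝ → T → A → (ι → ℝ) → ℝ := fun θ x a w =>
    expSum h lam (z θ w) ^ (p - 1) * (Real.exp (lam * h (z θ w x)) * g (z θ w x) a) with hQ
  set D : ℝ → T → A → (ι → ℝ) → ℝ := fun θ x a w =>
    (p - 1) * expSum h lam (z θ w) ^ (p - 1 - 1) *
      (lam * ∑ x', Real.exp (lam * h (z θ w x')) *
        ∑ b, g (z θ w x') b * (Z θ x' b ⬝ᵥ Z' θ x a)) *
      (Real.exp (lam * h (z θ w x)) * g (z θ w x) a) with hD
  have hQc : ∀ θ x a, Continuous (Q θ x a) := fun θ x a =>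
    (hGr θ _).mul ((hec θ x).mul (hgc θ x a))
  have heg : ∀ θ w x a, |Real.exp (lam * h (z θ w x)) * g (z θ w x) a| ≤
      expSum h lam (z θ w) := by
    intro θ w x a
    rw [abs_mul, abs_of_pos (Real.exp_pos _)]
    have := exp_le_expSum h lam (z θ w) x
    nlinarith [hg1 (z θ w x) a, Real.exp_pos (lam * h (z θ w x))]
  have hQ_le : ∀ θ x a w, |Q θ x a w| ≤ expSum h lam (z θ w) ^ p := by
    intro θ x a w
    have hpos := Real.rpow_pos_of_pos (hGpos θ w) (p - 1)
    simp only [hQ]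
    rw [abs_mul, abs_of_pos hpos, ← hpow1]
    exact mul_le_mul_of_nonneg_left (heg θ w x a) hpos.le
  have hQ_int : ∀ θ x a, Integrable (Q θ x a) (stdGauss ι) := fun θ x a =>
    integrable_stdGauss_of_le_exp (hQc θ x a) fun w => (hQ_le θ x a w).trans (hG_le θ w)
  have hvQ_int : ∀ θ x a, Integrable (fun w => (Z' θ x a ⬝ᵥ w) * Q θ x a w) (stdGauss ι) := by
    intro θ x a
    refine integrable_stdGauss_of_le_exp (C := L * cT ^ p) (B := B + 1)
      ((hdc _).mul (hQc θ x a)) fun w => ?_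
    rw [abs_mul]
    calc |Z' θ x a ⬝ᵥ w| * |Q θ x a w| ≤ (L * S w) * (cT ^ p * Real.exp (B * S w)) := by
          have := hS0 w
          gcongr
          exacts [hL' θ x a w, (hQ_le θ x a w).trans (hG_le θ w)]
      _ = L * cT ^ p * (S w * Real.exp (B * S w)) := by ring
      _ ≤ _ := by gcongr; exact hSexp w
  have hD_int : ∀ θ x a, Integrable (D θ x a) (stdGauss ι) := by
    intro θ x a
    set M : ℝ := ∑ x', ∑ b, |Z θ x' b ⬝ᵥ Z' θ x a| with hM
    have hM0 : 0 ≤ M := by positivity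
    refine integrable_stdGauss_of_le_exp (C := |p - 1| * (lam * M) * cT ^ p) (B := B)
      ?_ fun w => ?_
    · exact ((continuous_const.mul (hGr θ _)).mul (continuous_const.mul
        (continuous_finsetSum _ fun x' _ => (hec θ x').mul (continuous_finsetSum _ fun b _ =>
          (hgc θ x' b).mul continuous_const)))).mul ((hec θ x).mul (hgc θ x a))
    · have h1 := abs_sum_mul_exp_le h lam (z θ w)
        (fun x' => ∑ b, g (z θ w x') b * (Z θ x' b ⬝ᵥ Z' θ x a)) (M := M) fun x' => by
          refine (Finset.abs_sum_le_sum_abs _ _).trans ?_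
          refine (Finset.sum_le_sum fun b _ => ?_).trans (Finset.single_le_sum
            (f := fun x' => ∑ b, |Z θ x' b ⬝ᵥ Z' θ x a|) (fun _ _ => by positivity)
            (Finset.mem_univ x'))
          rw [abs_mul]
          nlinarith [hg1 (z θ w x') b, abs_nonneg (Z θ x' b ⬝ᵥ Z' θ x a)]
      have hpos := Real.rpow_pos_of_pos (hGpos θ w) (p - 1 - 1)
      have hG0 := (hGpos θ w).le
      simp only [hD]
      rw [abs_mul, abs_mul, abs_mul, abs_mul, abs_of_pos hpos, abs_of_pos hlam]
      calc _ ≤ |p - 1| * expSum h lam (z θ w) ^ (p - 1 - 1) *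
            (lam * (expSum h lam (z θ w) * M)) * expSum h lam (z θ w) := by
            gcongr
            exact heg θ w x a
        _ = |p - 1| * (lam * M) * expSum h lam (z θ w) ^ p := by
            rw [← hpow1, ← hpow2]; ring
        _ ≤ |p - 1| * (lam * M) * (cT ^ p * Real.exp (B * S w)) := by
            gcongr
            exact hG_le θ w
        _ = _ := by ring
  have hline : ∀ θ x a w, HasLineDerivAt ℝ (Q θ x a) (D θ x a w) w (Z' θ x a) := by
    intro θ x a w
    unfold HasLineDerivAt
    have hzt : ∀ (t : ℝ) x' b, z θ (w + t • Z' θ x a) x' b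
        = z θ w x' b + t * (Z θ x' b ⬝ᵥ Z' θ x a) := by
      intro t x' b
      simp only [hz, dotProduct_add, dotProduct_smul, smul_eq_mul]
    have hzx : ∀ t : ℝ, z θ (w + t • Z' θ x a) x = z θ w x := by
      intro t
      funext b
      rw [hzt, hZZ', hdiag]
      simp
    have h0 : z θ (w + (0 : ℝ) • Z' θ x a) = z θ w := by simp
    have h1 := hasDerivAt_expSum_rpow hh lam (p - 1) (t := 0)
      (ζ := fun t : ℝ => z θ (w + t • Z' θ x a))
      (ζ' := fun x' b => Z θ x' b ⬝ᵥ Z' θ x a) fun x' b => by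
        simp only [hzt]
        simpa using ((hasDerivAt_id (0 : ℝ)).mul_const (Z θ x' b ⬝ᵥ Z' θ x a)).const_add
          (z θ w x' b)
    have h2 := h1.mul_const (Real.exp (lam * h (z θ w x)) * g (z θ w x) a)
    simp only [h0] at h2
    simpa only [hQ, hD, hzx] using h2
  have hJ' : ∀ θ ∈ Set.Icc 0 (Real.pi / 2), ∫ w, F' θ w ∂(stdGauss ι) ≤ 0 := by
    intro θ hθ
    have hsc : 0 ≤ Real.sin θ * Real.cos θ :=
      mul_nonneg (Real.sin_nonneg_of_nonneg_of_le_pi hθ.1 (by linarith [hθ.2, Real.pi_pos]))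
        (Real.cos_nonneg_of_neg_pi_div_two_le_of_le (by linarith [hθ.1, Real.pi_pos]) hθ.2)
    have h1 : ∀ w, F' θ w = p * lam * ∑ x, ∑ a, (Z' θ x a ⬝ᵥ w) * Q θ x a w := by
      intro w
      simp only [hF', hQ, Finset.mul_sum]
      refine Finset.sum_congr rfl fun x _ => Finset.sum_congr rfl fun a _ => ?_
      ring
    simp_rw [h1]
    rw [integral_const_mul, integral_finsetSum _ fun x _ =>
      integrable_finsetSum _ fun a _ => hvQ_int θ x a]
    have h2 : ∑ x, ∫ w, ∑ a, (Z' θ x a ⬝ᵥ w) * Q θ x a w ∂(stdGauss ι)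
        = ∫ w, ∑ x, ∑ a, D θ x a w ∂(stdGauss ι) := by
      rw [integral_finsetSum _ fun x _ => integrable_finsetSum _ fun a _ => hD_int θ x a]
      refine Finset.sum_congr rfl fun x _ => ?_
      rw [integral_finsetSum _ fun a _ => hvQ_int θ x a,
        integral_finsetSum _ fun a _ => hD_int θ x a]
      exact Finset.sum_congr rfl fun a _ => integral_dotProduct_mul_stdGauss (hQ_int θ x a)
        (hD_int θ x a) (hvQ_int θ x a) (hline θ x a)
    rw [h2]
    refine mul_nonpos_of_nonneg_of_nonpos (by positivity) (integral_nonpos fun w => ?_)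
    have h3 : ∑ x, ∑ a, D θ x a w = (p - 1) * (expSum h lam (z θ w) ^ (p - 1 - 1) * lam *
        (Real.sin θ * Real.cos θ) * ∑ x, ∑ x', Real.exp (lam * h (z θ w x)) *
          Real.exp (lam * h (z θ w x')) *
            ∑ a, ∑ b, g (z θ w x) a * g (z θ w x') b *
              (X x a ⬝ᵥ X x' b - Y x a ⬝ᵥ Y x' b)) := by
      simp only [hD, hZZ', Finset.mul_sum, Finset.sum_mul]
      refine Finset.sum_congr rfl fun x _ => ?_
      rw [Finset.sum_comm]
      refine Finset.sum_congr rfl fun x' _ => Finset.sum_congr rfl fun a _ =>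
        Finset.sum_congr rfl fun b _ => ?_
      ring
    show ∑ x, ∑ a, D θ x a w ≤ 0
    rw [h3]
    refine mul_nonpos_of_nonpos_of_nonneg (by linarith) ?_
    have hpos := Real.rpow_pos_of_pos (hGpos θ w) (p - 1 - 1)
    refine mul_nonneg (by positivity) (Finset.sum_nonneg fun x _ => Finset.sum_nonneg fun x' _ =>
      mul_nonneg (by positivity) (hcross _ _ _ _))
  have hanti : AntitoneOn (fun θ => ∫ w, expSum h lam (z θ w) ^ p ∂(stdGauss ι))
      (Set.Icc 0 (Real.pi / 2)) := by
    refine antitoneOn_of_deriv_nonpos (convex_Icc _ _)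
      (fun θ _ => (hJ θ).continuousAt.continuousWithinAt)
      (fun θ _ => (hJ θ).differentiableAt.differentiableWithinAt) fun θ hθ => ?_
    rw [(hJ θ).deriv]
    exact hJ' θ (interior_subset hθ)
  have hpi : 0 ≤ Real.pi / 2 := by positivity
  have := hanti (Set.left_mem_Icc.2 hpi) (Set.right_mem_Icc.2 hpi) hpi
  simpa [hz, hZ] using this

end Comparison

/-! ### The smoothed distance to the orthant -/

section Potential

variable {ι : Type*} [Fintype ι]

/-- The smoothed shortfall `√(ε² + ∑ i, (κ - y i)₊²)`: up to the regularization `ε`, the Euclidean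
distance of `y` to the orthant `{y | ∀ i, κ ≤ y i}`. -/
noncomputable def shortfall (κ ε : ℝ) (y : ι → ℝ) : ℝ := √(ε ^ 2 + ∑ i, max (κ - y i) 0 ^ 2)

lemma shortfall_pos (κ : ℝ) {ε : ℝ} (hε : 0 < ε) (y : ι → ℝ) : 0 < shortfall κ ε y :=
  Real.sqrt_pos.2 (by positivity)

lemma continuous_shortfall (κ ε : ℝ) : Continuous (shortfall κ ε : (ι → ℝ) → ℝ) := by
  unfold shortfall; fun_prop

lemma shortfall_of_forall_le {κ ε : ℝ} (hε : 0 ≤ ε) {y : ι → ℝ} (hy : ∀ i, κ ≤ y i) :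
    shortfall κ ε y = ε := by
  have : ∀ i, max (κ - y i) 0 = 0 := fun i => max_eq_right (by linarith [hy i])
  simp [shortfall, this, Real.sqrt_sq hε]

lemma hasDerivAt_max_sq (u : ℝ) : HasDerivAt (fun u : ℝ => max u 0 ^ 2) (2 * max u 0) u := by
  rcases lt_trichotomy u 0 with h | h | h
  · rw [max_eq_right h.le]
    refine ((hasDerivAt_const u (0 : ℝ)).congr_of_eventuallyEq ?_).congr_deriv (by simp)
    filter_upwards [Iio_mem_nhds h] with v hv
    simp [max_eq_right (show v ≤ 0 from (Set.mem_Iio.1 hv).le)]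
  · subst h
    rw [hasDerivAt_iff_isLittleO]
    simp only [max_self, mul_zero, smul_zero, sub_zero, ne_eq, OfNat.ofNat_ne_zero,
      not_false_eq_true, zero_pow]
    have h2 : (fun u : ℝ => u ^ 2) =o[𝓝 0] fun u : ℝ => u := by
      simpa using Asymptotics.isLittleO_pow_pow (𝕜 := ℝ) (m := 1) (n := 2) (by norm_num)
    refine Asymptotics.IsBigO.trans_isLittleO (Asymptotics.IsBigO.of_bound 1
      (Eventually.of_forall fun u => ?_)) h2
    rw [Real.norm_of_nonneg (by positivity), Real.norm_of_nonneg (by positivity), one_mul]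
    rcases le_total u 0 with h | h
    · rw [max_eq_right h]; nlinarith [sq_nonneg u]
    · rw [max_eq_left h]
  · rw [max_eq_left h.le]
    refine ((hasDerivAt_pow 2 u).congr_of_eventuallyEq ?_).congr_deriv (by simp)
    filter_upwards [Ioi_mem_nhds h] with v hv
    simp [max_eq_left (show 0 ≤ v from (Set.mem_Ioi.1 hv).le)]

/-- The function `z none - shortfall κ ε (z ∘ some)` to which the Gaussian comparison is applied. -/
noncomputable def potential (κ ε : ℝ) (z : Option ι → ℝ) : ℝ :=
  z none - shortfall κ ε fun i => z (some i)

/-- The gradient of `potential`. Its entries at `some i` form a vector of norm at most one. -/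
noncomputable def potentialGrad (κ ε : ℝ) (z : Option ι → ℝ) : Option ι → ℝ
  | none => 1
  | some i => max (κ - z (some i)) 0 / shortfall κ ε fun i => z (some i)

lemma hasFDerivAt_potential (κ : ℝ) {ε : ℝ} (hε : 0 < ε) (z : Option ι → ℝ) :
    HasFDerivAt (potential κ ε)
      (∑ a, potentialGrad κ ε z a •
        (ContinuousLinearMap.proj a : (Option ι → ℝ) →L[ℝ] ℝ)) z := by
  have hpr : ∀ a, HasFDerivAt (fun z : Option ι → ℝ => z a)
      (ContinuousLinearMap.proj a : (Option ι → ℝ) →L[ℝ] ℝ) z := fun a => hasFDerivAt_apply a z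
  have h1 : ∀ i, HasFDerivAt (fun z : Option ι → ℝ => max (κ - z (some i)) 0 ^ 2)
      ((2 * max (κ - z (some i)) 0) •
        -(ContinuousLinearMap.proj (some i) : (Option ι → ℝ) →L[ℝ] ℝ)) z := fun i =>
    (hasDerivAt_max_sq (κ - z (some i))).comp_hasFDerivAt (f := fun z : Option ι → ℝ => κ - z (some i)) z
      ((hpr (some i)).const_sub κ)
  have h2 := ((HasFDerivAt.fun_sum (u := Finset.univ) fun i _ => h1 i).const_add (ε ^ 2)).sqrt
    (by positivity)
  have h3 := (hpr none).sub h2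
  convert! h3 using 1
  ext v
  simp only [Fintype.sum_option, potentialGrad, one_smul, shortfall, add_apply, sum_apply,
    smul_apply, neg_apply, ContinuousLinearMap.proj_apply, smul_eq_mul,
    Finset.mul_sum, sub_eq_add_neg, ← Finset.sum_neg_distrib]
  congr 1
  refine Finset.sum_congr rfl fun i _ => ?_
  field_simp

lemma continuous_potentialGrad (κ : ℝ) {ε : ℝ} (hε : 0 < ε) (a : Option ι) :
    Continuous fun z : Option ι → ℝ => potentialGrad κ ε z a := by
  cases a with
  | none => exact continuous_const
  | some i =>
    refine Continuous.div (by fun_prop) ((continuous_shortfall κ ε).comp (by fun_prop))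
      fun z => (shortfall_pos κ hε _).ne'

lemma sum_potentialGrad_sq_le (κ : ℝ) {ε : ℝ} (hε : 0 < ε) (z : Option ι → ℝ) :
    ∑ i, potentialGrad κ ε z (some i) ^ 2 ≤ 1 := by
  simp only [potentialGrad, div_pow]
  rw [← Finset.sum_div, div_le_one (by have := shortfall_pos κ hε (fun i => z (some i)); positivity),
    shortfall, Real.sq_sqrt (by positivity)]
  nlinarith [sq_nonneg ε]

lemma abs_potentialGrad_le (κ : ℝ) {ε : ℝ} (hε : 0 < ε) (z : Option ι → ℝ) (a : Option ι) :
    |potentialGrad κ ε z a| ≤ 1 := by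
  cases a with
  | none => simp [potentialGrad]
  | some i =>
    rw [← sq_le_one_iff_abs_le_one]
    exact (Finset.single_le_sum (f := fun i => potentialGrad κ ε z (some i) ^ 2)
      (fun _ _ => sq_nonneg _) (Finset.mem_univ i)).trans (sum_potentialGrad_sq_le κ hε z)

lemma potential_le (κ : ℝ) {ε : ℝ} (hε : 0 < ε) (z : Option ι → ℝ) :
    potential κ ε z ≤ ∑ a, |z a| := by
  rw [Fintype.sum_option, potential]
  have h1 := le_abs_self (z none)
  have h2 := shortfall_pos κ hε fun i => z (some i)
  have h3 : 0 ≤ ∑ i, |z (some i)| := by positivity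
  linarith

lemma sum_potentialGrad_mul_le (κ : ℝ) {ε : ℝ} (hε : 0 < ε) (z z' : Option ι → ℝ) :
    ∑ i, potentialGrad κ ε z (some i) * potentialGrad κ ε z' (some i) ≤ 1 := by
  have h1 := sum_potentialGrad_sq_le κ hε z
  have h2 := sum_potentialGrad_sq_le κ hε z'
  have h3 : ∑ i, potentialGrad κ ε z (some i) * potentialGrad κ ε z' (some i) ≤
      ∑ i, (potentialGrad κ ε z (some i) ^ 2 / 2 + potentialGrad κ ε z' (some i) ^ 2 / 2) :=
    Finset.sum_le_sum fun i _ => by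
      nlinarith [sq_nonneg (potentialGrad κ ε z (some i) - potentialGrad κ ε z' (some i))]
  rw [Finset.sum_add_distrib, ← Finset.sum_div, ← Finset.sum_div] at h3
  linarith

end Potential

/-! ### The lifted Gordon bound -/

section Gordon

variable {m n : ℕ} {T : Type*} [Fintype T]

/-- Coordinates of the Gaussian vector of the comparison: the entries of `H` and a scalar on the
left, a vector in `ℝⁿ` and a vector in `ℝᵐ` on the right. -/
abbrev GordonIndex (m n : ℕ) : Type := ((Fin m × Fin n) ⊕ Unit) ⊕ (Fin n ⊕ Fin m)

/-- Coefficients of the bilinear family `x ↦ (g₀, H x)`. -/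
def bilinearCoeff (x : Fin n → ℝ) : Option (Fin m) → GordonIndex m n → ℝ
  | none => Sum.elim (Sum.elim 0 1) 0
  | some i => Sum.elim (Sum.elim (fun ij => if ij.1 = i then x ij.2 else 0) 0) 0

/-- Coefficients of the decoupled family `x ↦ (⟨h, x⟩, g)`. -/
def decoupledCoeff (x : Fin n → ℝ) : Option (Fin m) → GordonIndex m n → ℝ
  | none => Sum.elim 0 (Sum.elim x 0)
  | some i => Sum.elim 0 (Sum.elim 0 (Pi.single i 1))

/-- The product `H x`, for `H` given by the function of its entries. -/
def mulVecEntries (H : Fin m × Fin n → ℝ) (x : Fin n → ℝ) (i : Fin m) : ℝ := ∑ j, H (i, j) * x j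

lemma bilinearCoeff_none_dotProduct (x : Fin n → ℝ) (w : GordonIndex m n → ℝ) :
    bilinearCoeff x none ⬝ᵥ w = w (.inl (.inr ())) := by
  simp [bilinearCoeff, dotProduct]

lemma bilinearCoeff_some_dotProduct (x : Fin n → ℝ) (i : Fin m) (w : GordonIndex m n → ℝ) :
    bilinearCoeff x (some i) ⬝ᵥ w = mulVecEntries (fun ij => w (.inl (.inl ij))) x i := by
  simp [bilinearCoeff, dotProduct, mulVecEntries, Fintype.sum_prod_type, mul_comm]

lemma decoupledCoeff_none_dotProduct (x : Fin n → ℝ) (w : GordonIndex m n → ℝ) :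
    decoupledCoeff x none ⬝ᵥ w = ∑ j, x j * w (.inr (.inl j)) := by
  simp [decoupledCoeff, dotProduct]

lemma decoupledCoeff_some_dotProduct (x : Fin n → ℝ) (i : Fin m) (w : GordonIndex m n → ℝ) :
    decoupledCoeff x (some i) ⬝ᵥ w = w (.inr (.inr i)) := by
  simp [decoupledCoeff, dotProduct, Pi.single_apply]

lemma bilinearCoeff_dotProduct_decoupledCoeff (x x' : Fin n → ℝ) (a b : Option (Fin m)) :
    bilinearCoeff x a ⬝ᵥ decoupledCoeff x' b = 0 := by
  cases a <;> cases b <;> simp [bilinearCoeff, decoupledCoeff, dotProduct]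

lemma bilinearCoeff_dotProduct_self (x x' : Fin n → ℝ) (a b : Option (Fin m)) :
    bilinearCoeff x a ⬝ᵥ bilinearCoeff x' b =
      if a = b then (if a = none then 1 else x ⬝ᵥ x') else 0 := by
  cases a with
  | none => cases b <;> simp [bilinearCoeff, dotProduct]
  | some i =>
    rw [bilinearCoeff_some_dotProduct]
    cases b with
    | none => simp [bilinearCoeff, mulVecEntries]
    | some k =>
      by_cases h : i = k
      · simp [bilinearCoeff, mulVecEntries, dotProduct, h, mul_comm]
      · simp [bilinearCoeff, mulVecEntries, h]

lemma decoupledCoeff_dotProduct_self (x x' : Fin n → ℝ) (a b : Option (Fin m)) :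
    decoupledCoeff x a ⬝ᵥ decoupledCoeff x' b =
      if a = b then (if a = none then x ⬝ᵥ x' else 1) else 0 := by
  cases a with
  | none => cases b <;> simp [decoupledCoeff, dotProduct]
  | some i =>
    rw [decoupledCoeff_some_dotProduct]
    cases b <;> simp [decoupledCoeff, Pi.single_apply]

lemma dotProduct_le_one {x x' : Fin n → ℝ} (hx : ∑ j, x j ^ 2 = 1) (hx' : ∑ j, x' j ^ 2 = 1) :
    x ⬝ᵥ x' ≤ 1 := by
  have := Real.sum_mul_le_sqrt_mul_sqrt Finset.univ x x'
  simpa [hx, hx', dotProduct] using this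

/-- The comparison theorem for the bilinear and the decoupled family over a finite set of unit
vectors. -/
lemma integral_bilinear_le_integral_decoupled [Nonempty T] (κ : ℝ) {ε : ℝ} (hε : 0 < ε)
    {x : T → Fin n → ℝ} (hx : ∀ t, ∑ j, x t j ^ 2 = 1) {lam p : ℝ} (hlam : 0 < lam)
    (hp : 0 < p) (hp1 : p ≤ 1) :
    ∫ w, expSum (potential κ ε) lam (fun t a => bilinearCoeff (m := m) (x t) a ⬝ᵥ w) ^ p
        ∂(stdGauss (GordonIndex m n)) ≤
      ∫ w, expSum (potential κ ε) lam (fun t a => decoupledCoeff (m := m) (x t) a ⬝ᵥ w) ^ p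
        ∂(stdGauss (GordonIndex m n)) := by
  refine integral_expSum_rpow_le (g := potentialGrad κ ε) (hasFDerivAt_potential κ hε)
    (continuous_potentialGrad κ hε) (abs_potentialGrad_le κ hε) (potential_le κ hε)
    (fun _ _ _ _ => bilinearCoeff_dotProduct_decoupledCoeff _ _ _ _) (fun t a b => ?_)
    (fun t t' z z' => ?_) hlam hp hp1
  · have : x t ⬝ᵥ x t = 1 := by simpa [dotProduct, sq] using hx t
    simp [bilinearCoeff_dotProduct_self, decoupledCoeff_dotProduct_self, this]
  · have h1 := dotProduct_le_one (hx t) (hx t')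
    have h2 := sum_potentialGrad_mul_le κ hε z z'
    have h3 : ∑ a, ∑ b, potentialGrad κ ε z a * potentialGrad κ ε z' b *
        (bilinearCoeff (m := m) (x t) a ⬝ᵥ bilinearCoeff (x t') b -
          decoupledCoeff (m := m) (x t) a ⬝ᵥ decoupledCoeff (x t') b) =
        (1 - x t ⬝ᵥ x t') *
          (1 - ∑ i, potentialGrad κ ε z (some i) * potentialGrad κ ε z' (some i)) := by
      simp only [bilinearCoeff_dotProduct_self, decoupledCoeff_dotProduct_self,
        Fintype.sum_option]
      simp only [reduceCtorEq, if_true, if_false, Option.some.injEq, sub_self, mul_zero,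
        Finset.sum_const_zero, add_zero, zero_add, mul_sub, mul_ite, mul_one,
        Finset.sum_sub_distrib, Finset.sum_ite_eq, Finset.mem_univ, ← Finset.sum_mul]
      simp only [potentialGrad]
      ring
    rw [h3]
    exact mul_nonneg (by linarith) (by linarith)

lemma continuous_mulVecEntries (x : Fin n → ℝ) :
    Continuous fun H : Fin m × Fin n → ℝ => mulVecEntries H x :=
  continuous_pi fun i => by simp only [mulVecEntries]; fun_prop

lemma integral_exp_mul_stdGauss_unit (c : ℝ) :
    ∫ u : Unit → ℝ, Real.exp (c * u ()) ∂(stdGauss Unit) = Real.exp (c ^ 2 / 2) := by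
  have h := integral_fintype_prod_eq_prod (𝕜 := ℝ) (ι := Unit) (μ := fun _ => gaussianReal 0 1)
    (f := fun _ (t : ℝ) => Real.exp (c * t))
  simp only [Finset.univ_unique, Finset.prod_singleton] at h
  have h2 := congrFun (mgf_fun_id_gaussianReal (μ := 0) (v := 1)) c
  simp only [mgf] at h2
  simp only [stdGauss]
  convert! h.trans h2 using 2
  simp

lemma sqrt_sum_sq_le_sum_abs {ι : Type*} [Fintype ι] (v : ι → ℝ) :
    √(∑ j, v j ^ 2) ≤ ∑ j, |v j| := by
  refine Real.sqrt_le_iff.2 ⟨by positivity, ?_⟩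
  calc ∑ j, v j ^ 2 = ∑ j, |v j| * |v j| := by simp [sq]
    _ ≤ ∑ j, |v j| * ∑ k, |v k| := Finset.sum_le_sum fun j _ =>
        mul_le_mul_of_nonneg_left (Finset.single_le_sum (f := fun k => |v k|)
          (fun _ _ => abs_nonneg _) (Finset.mem_univ j)) (abs_nonneg _)
    _ = _ := by rw [← Finset.sum_mul, sq]

/-- **Lifted Gordon bound** over finitely many unit vectors: the probability that some `H x`
is within `a` of the orthant `{y | ∀ i, κ ≤ y i}`, in the sense of `shortfall`. -/
theorem measure_exists_shortfall_lt_le (κ : ℝ) {ε c : ℝ} (hε : 0 < ε) (hc : 0 < c) (a : ℝ)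
    {x : T → Fin n → ℝ} (hx : ∀ t, ∑ j, x t j ^ 2 = 1) :
    Real.exp (c ^ 2 / 2) * Real.exp (-c * a) * (stdGauss (Fin m × Fin n)).real
        {H | ∃ t, shortfall κ ε (mulVecEntries H (x t)) < a} ≤
      (∫ v, Real.exp (c * √(∑ j, v j ^ 2)) ∂(stdGauss (Fin n))) *
        ∫ y, Real.exp (-c * shortfall κ ε y) ∂(stdGauss (Fin m)) := by
  rcases isEmpty_or_nonempty T with hT | hT
  · simp only [IsEmpty.exists_iff, Set.ofPred_false, measureReal_empty, mul_zero]
    exact mul_nonneg (integral_nonneg fun _ => (Real.exp_pos _).le)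
      (integral_nonneg fun _ => (Real.exp_pos _).le)
  set E : Set (Fin m × Fin n → ℝ) := {H | ∃ t, shortfall κ ε (mulVecEntries H (x t)) < a} with hE
  have hEm : MeasurableSet E := by
    have : E = ⋃ t, {H | shortfall κ ε (mulVecEntries H (x t)) < a} := by
      ext H; simp [hE]
    rw [this]
    exact MeasurableSet.iUnion fun t => (isOpen_lt
      ((continuous_shortfall κ ε).comp (continuous_mulVecEntries (x t)))
      continuous_const).measurableSet
  set I1 := ∫ v, Real.exp (c * √(∑ j, v j ^ 2)) ∂(stdGauss (Fin n)) with hI1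
  set I2 := ∫ y, Real.exp (-c * shortfall κ ε y) ∂(stdGauss (Fin m)) with hI2
  have hpc : Continuous (potential κ ε : (Option (Fin m) → ℝ) → ℝ) :=
    continuous_iff_continuousAt.2 fun z => (hasFDerivAt_potential κ hε z).continuousAt
  -- the bound up to the number of vectors, to the power `p`
  have key : ∀ p : ℝ, 0 < p → p ≤ 1 →
      Real.exp (c ^ 2 / 2) * Real.exp (-c * a) * (stdGauss (Fin m × Fin n)).real E ≤
        (Fintype.card T : ℝ) ^ p * (I1 * I2) := by
    intro p hp hp1
    have hlam : 0 < c / p := div_pos hc hp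
    have hpow : ∀ s : ℝ, Real.exp (c / p * s) ^ p = Real.exp (c * s) := fun s => by
      rw [← Real.exp_mul]; congr 1; field_simp
    have hX := integrable_expSum_rpow hpc (potential_le κ hε)
      (fun t a => bilinearCoeff (m := m) (x t) a) hlam hp
    have hcomp := integral_bilinear_le_integral_decoupled (m := m) κ hε hx hlam hp hp1
    have hlow : ∫ w : GordonIndex m n → ℝ,
        (E.indicator (fun _ => Real.exp (-c * a)) fun ij => w (.inl (.inl ij))) *
          Real.exp (c * w (.inl (.inr ()))) ∂(stdGauss (GordonIndex m n)) =
        Real.exp (c ^ 2 / 2) * Real.exp (-c * a) * (stdGauss (Fin m × Fin n)).real E := by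
      have h1 := integral_mul_stdGauss_sum (α := (Fin m × Fin n) ⊕ Unit) (β := Fin n ⊕ Fin m)
        (fun u => (E.indicator (fun _ => Real.exp (-c * a)) fun ij => u (.inl ij)) *
          Real.exp (c * u (.inr ()))) (fun _ => 1)
      have h2 := integral_mul_stdGauss_sum (α := Fin m × Fin n) (β := Unit)
        (E.indicator (fun _ => Real.exp (-c * a))) (fun u => Real.exp (c * u ()))
      rw [h2, integral_exp_mul_stdGauss_unit, integral_indicator_const _ hEm] at h1
      simp only [mul_one, integral_const, probReal_univ, smul_eq_mul] at h1
      rw [h1]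
      ring
    have hupp : ∫ w : GordonIndex m n → ℝ,
        Real.exp (c * √(∑ j, w (.inr (.inl j)) ^ 2)) *
          Real.exp (-c * shortfall κ ε fun i => w (.inr (.inr i))) ∂(stdGauss (GordonIndex m n)) =
        I1 * I2 := by
      have h1 := integral_mul_stdGauss_sum (α := (Fin m × Fin n) ⊕ Unit) (β := Fin n ⊕ Fin m)
        (fun _ => 1) (fun u => Real.exp (c * √(∑ j, u (.inl j) ^ 2)) *
          Real.exp (-c * shortfall κ ε fun i => u (.inr i)))
      have h2 := integral_mul_stdGauss_sum (α := Fin n) (β := Fin m)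
        (fun v => Real.exp (c * √(∑ j, v j ^ 2))) (fun y => Real.exp (-c * shortfall κ ε y))
      rw [h2] at h1
      simpa only [integral_const, probReal_univ, one_smul, one_mul] using h1
    have huppI : Integrable (fun w : GordonIndex m n → ℝ =>
        Real.exp (c * √(∑ j, w (.inr (.inl j)) ^ 2)) *
          Real.exp (-c * shortfall κ ε fun i => w (.inr (.inr i))))
        (stdGauss (GordonIndex m n)) := by
      refine integrable_stdGauss_of_le_exp (C := 1) (B := c) (Continuous.mul (by fun_prop)
        (Real.continuous_exp.comp (continuous_const.mul
          ((continuous_shortfall κ ε).comp (by fun_prop))))) fun w => ?_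
      rw [abs_of_pos (by positivity), one_mul, ← Real.exp_add]
      refine Real.exp_le_exp.2 ?_
      have h1 := sqrt_sum_sq_le_sum_abs fun j => w (.inr (.inl j))
      have h2 : ∑ j, |w (.inr (.inl j))| ≤ ∑ k, |w k| := by
        rw [Fintype.sum_sum_type, Fintype.sum_sum_type (fun k => |w (.inr k)|)]
        have h3 : 0 ≤ ∑ k, |w (.inl k)| := by positivity
        have h4 : 0 ≤ ∑ i, |w (.inr (.inr i))| := by positivity
        linarith
      have h3 := shortfall_pos κ hε fun i => w (.inr (.inr i))
      nlinarith
    rw [← hlow, ← hupp, ← integral_const_mul]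
    refine (integral_mono_of_nonneg (ae_of_all _ fun w => ?_) hX (ae_of_all _ fun w => ?_)).trans
      (hcomp.trans (integral_mono_of_nonneg (ae_of_all _ fun w => ?_) (huppI.const_mul _)
        (ae_of_all _ fun w => ?_)))
    · exact mul_nonneg (Set.indicator_nonneg (fun _ _ => (Real.exp_pos _).le) _)
        (Real.exp_pos _).le
    · by_cases hw : (fun ij => w (.inl (.inl ij))) ∈ E
      · obtain ⟨t, ht⟩ := id hw
        simp only [Set.indicator_of_mem hw]
        have h1 := Real.rpow_le_rpow (Real.exp_pos _).le (exp_le_expSum (potential κ ε) (c / p)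
          (fun t a => bilinearCoeff (m := m) (x t) a ⬝ᵥ w) t) hp.le
        rw [hpow] at h1
        refine le_trans ?_ h1
        rw [← Real.exp_add]
        refine Real.exp_le_exp.2 ?_
        simp only [potential, bilinearCoeff_none_dotProduct, bilinearCoeff_some_dotProduct]
        have : shortfall κ ε (fun i => mulVecEntries (fun ij => w (.inl (.inl ij))) (x t) i) < a :=
          ht
        nlinarith
      · simp only [Set.indicator_of_notMem hw, zero_mul]
        exact (Real.rpow_pos_of_pos (expSum_pos _ _ _) _).le
    · exact (Real.rpow_pos_of_pos (expSum_pos _ _ _) _).le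
    · have h1 : expSum (potential κ ε) (c / p)
          (fun t a => decoupledCoeff (m := m) (x t) a ⬝ᵥ w) ≤
          Fintype.card T * Real.exp (c / p * (√(∑ j, w (.inr (.inl j)) ^ 2) -
            shortfall κ ε fun i => w (.inr (.inr i)))) := by
        have : ∀ t ∈ (Finset.univ : Finset T), Real.exp (c / p * potential κ ε
            (fun a => decoupledCoeff (m := m) (x t) a ⬝ᵥ w)) ≤
            Real.exp (c / p * (√(∑ j, w (.inr (.inl j)) ^ 2) -
              shortfall κ ε fun i => w (.inr (.inr i)))) := by
          intro t _
          refine Real.exp_le_exp.2 (mul_le_mul_of_nonneg_left ?_ hlam.le)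
          simp only [potential, decoupledCoeff_none_dotProduct, decoupledCoeff_some_dotProduct]
          have h2 := Real.sum_mul_le_sqrt_mul_sqrt Finset.univ (x t)
            (fun j => w (.inr (.inl j)))
          rw [hx t, Real.sqrt_one, one_mul] at h2
          linarith
        simpa [expSum] using Finset.sum_le_sum this
      refine (Real.rpow_le_rpow (expSum_pos _ _ _).le h1 hp.le).trans_eq ?_
      rw [Real.mul_rpow (by positivity) (Real.exp_pos _).le, hpow]
      beta_reduce
      rw [← Real.exp_add]
      congr 2
      ring
  have hlim : Tendsto (fun p : ℝ => (Fintype.card T : ℝ) ^ p * (I1 * I2)) (𝓝[>] 0)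
      (𝓝 ((Fintype.card T : ℝ) ^ (0 : ℝ) * (I1 * I2))) := by
    refine Tendsto.mul_const _ (Tendsto.mono_left ?_ nhdsWithin_le_nhds)
    exact (Real.continuous_const_rpow (by simp)).tendsto 0
  rw [Real.rpow_zero, one_mul] at hlim
  refine ge_of_tendsto hlim ?_
  filter_upwards [Ioc_mem_nhdsGT (show (0 : ℝ) < 1 by norm_num)] with p hp using key p hp.1 hp.2

end Gordon

/-! ### Gaussian integrals -/

section OneDim

lemma integral_gaussianReal_std (f : ℝ → ℝ) :
    ∫ t, f t ∂(gaussianReal 0 1) = (√(2 * Real.pi))⁻¹ * ∫ t, Real.exp (-t ^ 2 / 2) * f t := by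
  rw [integral_gaussianReal_eq_integral_smul one_ne_zero, ← integral_const_mul]
  refine integral_congr_ae (ae_of_all _ fun t => ?_)
  simp [gaussianPDFReal, mul_assoc]

lemma integral_exp_mul_sq_gaussianReal {b : ℝ} (hb : 2 * b < 1) :
    ∫ t, Real.exp (b * t ^ 2) ∂(gaussianReal 0 1) = (√(1 - 2 * b))⁻¹ := by
  rw [integral_gaussianReal_std]
  have h1 : ∀ t : ℝ, Real.exp (-t ^ 2 / 2) * Real.exp (b * t ^ 2)
      = Real.exp (-(1 / 2 - b) * t ^ 2) := fun t => by
    rw [← Real.exp_add]; congr 1; ring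
  simp_rw [h1]
  rw [integral_gaussian, ← Real.sqrt_inv, ← Real.sqrt_mul (by positivity), ← Real.sqrt_inv]
  congr 1
  have h2 : 1 - 2 * b ≠ 0 := by linarith
  have h3 : 1 / 2 - b ≠ 0 := by intro h; apply h2; linarith
  have h4 := Real.pi_ne_zero
  field_simp

lemma integral_Ioi_comp_add (F : ℝ → ℝ) (a d : ℝ) :
    ∫ t in Set.Ioi a, F (t + d) = ∫ t in Set.Ioi (a + d), F t := by
  have h := (measurePreserving_add_right volume d).setIntegral_preimage_emb
    (MeasurableEquiv.addRight d).measurableEmbedding F (Set.Ioi (a + d))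
  rw [← h]
  congr 2
  ext t
  simp

lemma integral_Ioi_exp_neg_mul_sq {p : ℝ} (hp : 0 < p) (a d : ℝ) :
    ∫ t in Set.Ioi a, Real.exp (-(p / 2 * (t + d) ^ 2)) =
      √(2 * Real.pi) / (2 * √p) * erfc (√p * (a + d) / √2) := by
  have hs : 0 < √p / √2 := by positivity
  have h1 : ∀ t : ℝ, Real.exp (-(p / 2 * t ^ 2)) = Real.exp (-(√p / √2 * t) ^ 2) := fun t => by
    rw [mul_pow, div_pow, Real.sq_sqrt hp.le, Real.sq_sqrt (by norm_num)]
  rw [integral_Ioi_comp_add (fun t => Real.exp (-(p / 2 * t ^ 2)))]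
  simp_rw [h1]
  rw [integral_comp_mul_left_Ioi (fun u => Real.exp (-u ^ 2)) _ hs, erfc,
    show √p / √2 * (a + d) = √p * (a + d) / √2 by ring, smul_eq_mul,
    Real.sqrt_mul (by norm_num)]
  have h2 : √Real.pi ≠ 0 := (Real.sqrt_pos.2 Real.pi_pos).ne'
  have h3 : √p ≠ 0 := (Real.sqrt_pos.2 hp).ne'
  field_simp

/-- The closed form `Iper1` is the Gaussian expectation of `exp (-(c / 4γ) (κ - t)₊²)`. -/
lemma integral_exp_neg_max_sq_gaussianReal {c γ : ℝ} (hc : 0 < c) (hγ : 0 < γ) (κ : ℝ) :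
    ∫ t, Real.exp (-(c / (4 * γ)) * max (κ - t) 0 ^ 2) ∂(gaussianReal 0 1) = Iper1 c γ κ := by
  have hsym : ∫ t, Real.exp (-(c / (4 * γ)) * max (κ - t) 0 ^ 2) ∂(gaussianReal 0 1) =
      ∫ t, Real.exp (-(c / (4 * γ)) * max (κ + t) 0 ^ 2) ∂(gaussianReal 0 1) := by
    have h := gaussianReal_map_neg (μ := 0) (v := 1)
    rw [neg_zero] at h
    conv_lhs => rw [← h]
    rw [integral_map (by fun_prop) (by fun_prop)]
    simp
  have hp : 0 < 1 + c / (2 * γ) := by positivity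
  have hint : Integrable fun t : ℝ =>
      Real.exp (-t ^ 2 / 2) * Real.exp (-(c / (4 * γ)) * max (κ + t) 0 ^ 2) := by
    refine (integrable_exp_neg_mul_sq (b := 1 / 2) (by norm_num)).mono' (by fun_prop)
      (ae_of_all _ fun t => ?_)
    rw [Real.norm_of_nonneg (by positivity), ← Real.exp_add]
    refine Real.exp_le_exp.2 ?_
    have : 0 ≤ c / (4 * γ) * max (κ + t) 0 ^ 2 := by positivity
    linarith
  have hleft : ∫ t in Set.Iic (-κ),
      Real.exp (-t ^ 2 / 2) * Real.exp (-(c / (4 * γ)) * max (κ + t) 0 ^ 2) =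
      √(2 * Real.pi) / 2 * erfc (κ / √2) := by
    have h1 := integral_Ioi_exp_neg_mul_sq one_pos κ 0
    rw [← integral_comp_neg_Ioi]
    simp only [Real.sqrt_one, mul_one, add_zero, one_mul] at h1 ⊢
    rw [← h1]
    refine setIntegral_congr_fun measurableSet_Ioi fun t ht => ?_
    have : max (κ + -t) 0 = 0 := max_eq_right (by linarith [Set.mem_Ioi.1 ht])
    simp only [this]
    rw [← Real.exp_add]
    congr 1
    ring
  have hright : ∫ t in Set.Ioi (-κ),
      Real.exp (-t ^ 2 / 2) * Real.exp (-(c / (4 * γ)) * max (κ + t) 0 ^ 2) =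
      Real.exp ((c * κ / (2 * γ)) ^ 2 / (2 * (1 + c / (2 * γ))) - c * κ ^ 2 / (4 * γ)) *
        (√(2 * Real.pi) / (2 * √(1 + c / (2 * γ))) *
          erfc ((-κ * √(1 + c / (2 * γ)) + c * κ / (2 * γ) / √(1 + c / (2 * γ))) / √2)) := by
    have h1 := integral_Ioi_exp_neg_mul_sq hp (-κ) (c * κ / (2 * γ) / (1 + c / (2 * γ)))
    have h2 : √(1 + c / (2 * γ)) * (-κ + c * κ / (2 * γ) / (1 + c / (2 * γ))) =
        -κ * √(1 + c / (2 * γ)) + c * κ / (2 * γ) / √(1 + c / (2 * γ)) := by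
      have h3 : √(1 + c / (2 * γ)) ≠ 0 := (Real.sqrt_pos.2 hp).ne'
      nth_rewrite 2 [← Real.sq_sqrt hp.le]
      generalize √(1 + c / (2 * γ)) = S at h3 ⊢
      field_simp
    rw [h2] at h1
    rw [← h1, ← integral_const_mul]
    refine setIntegral_congr_fun measurableSet_Ioi fun t ht => ?_
    have : max (κ + t) 0 = κ + t := max_eq_left (by linarith [Set.mem_Ioi.1 ht])
    simp only [this]
    rw [← Real.exp_add, ← Real.exp_add]
    congr 1
    have h3 : 2 * γ + c ≠ 0 := by positivity
    have h4 : 1 + c / (2 * γ) = (2 * γ + c) / (2 * γ) := by field_simp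
    rw [h4]
    field_simp
    ring
  rw [hsym, integral_gaussianReal_std, ← intervalIntegral.integral_Iic_add_Ioi
    hint.integrableOn hint.integrableOn, hleft, hright]
  simp only [Iper1]
  have h5 : √(2 * Real.pi) ≠ 0 := (Real.sqrt_pos.2 (by positivity)).ne'
  have h6 : √(1 + c / (2 * γ)) ≠ 0 := (Real.sqrt_pos.2 hp).ne'
  generalize √(1 + c / (2 * γ)) = S at h6 ⊢
  generalize erfc (κ / √2) = e1
  generalize erfc _ = e2
  generalize Real.exp _ = e3
  field_simp

lemma Iper1_pos {c γ : ℝ} (hc : 0 < c) (hγ : 0 < γ) (κ : ℝ) : 0 < Iper1 c γ κ := by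
  rw [← integral_exp_neg_max_sq_gaussianReal hc hγ]
  refine integral_exp_pos ((integrable_const (1 : ℝ)).mono' (by fun_prop)
    (ae_of_all _ fun t => ?_))
  rw [Real.norm_of_nonneg (Real.exp_pos _).le, Real.exp_le_one_iff]
  have : 0 ≤ c / (4 * γ) * max (κ - t) 0 ^ 2 := by positivity
  linarith

end OneDim

section Moments

lemma integral_prod_stdGauss {ι : Type*} [Fintype ι] (f : ℝ → ℝ) :
    ∫ v : ι → ℝ, ∏ j, f (v j) ∂(stdGauss ι) =
      (∫ t, f t ∂(gaussianReal 0 1)) ^ Fintype.card ι := by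
  rw [stdGauss, integral_fintype_prod_eq_prod (f := fun _ => f)]
  simp

lemma gammaHat_gt (c : ℝ) : c / 2 < gammaHat c := by
  have h : 2 * c < √(4 * c ^ 2 + 16) := Real.lt_sqrt_of_sq_lt (by nlinarith)
  rw [gammaHat]
  linarith

/-- The spherical term bounds the exponential moment of the norm of a Gaussian vector. -/
lemma integral_exp_mul_norm_le {c : ℝ} (hc : 0 < c) {n : ℕ} :
    ∫ v, Real.exp (c * √n * √(∑ j, v j ^ 2)) ∂(stdGauss (Fin n)) ≤
      Real.exp (n * (c * Isph c)) := by
  set γ := gammaHat c with hγ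
  have hγ1 : c / 2 < γ := gammaHat_gt c
  have hγ0 : 0 < γ := by linarith
  have hb : c / (2 * γ) < 1 := by rw [div_lt_one (by positivity)]; linarith
  have hI : ∫ v : Fin n → ℝ, ∏ j, Real.exp (c / (4 * γ) * v j ^ 2) ∂(stdGauss (Fin n)) =
      (√(1 - c / (2 * γ)))⁻¹ ^ n := by
    rw [integral_prod_stdGauss fun t => Real.exp (c / (4 * γ) * t ^ 2),
      integral_exp_mul_sq_gaussianReal
        (by rw [show 2 * (c / (4 * γ)) = c / (2 * γ) by field_simp; norm_num]; exact hb),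
      Fintype.card_fin, show 2 * (c / (4 * γ)) = c / (2 * γ) by field_simp; norm_num]
  have hpos : 0 < (√(1 - c / (2 * γ)))⁻¹ := inv_pos.2 (Real.sqrt_pos.2 (by linarith))
  have hint : Integrable (fun v : Fin n → ℝ => ∏ j, Real.exp (c / (4 * γ) * v j ^ 2))
      (stdGauss (Fin n)) := Integrable.of_integral_ne_zero (by rw [hI]; positivity)
  calc _ ≤ ∫ v : Fin n → ℝ, Real.exp (c * γ * n) * ∏ j, Real.exp (c / (4 * γ) * v j ^ 2)
        ∂(stdGauss (Fin n)) := by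
        refine integral_mono_of_nonneg (ae_of_all _ fun v => (Real.exp_pos _).le)
          (hint.const_mul _) (ae_of_all _ fun v => ?_)
        beta_reduce
        rw [← Real.exp_sum, ← Real.exp_add, ← Finset.mul_sum]
        refine Real.exp_le_exp.2 ?_
        -- the inequality `√n * ‖v‖ ≤ γ * n + ‖v‖² / (4 * γ)`
        have h0 : (0 : ℝ) ≤ ∑ j, v j ^ 2 := by positivity
        have h1 : √(∑ j, v j ^ 2) ^ 2 = ∑ j, v j ^ 2 := Real.sq_sqrt h0
        have h2 : √(n : ℝ) ^ 2 = n := Real.sq_sqrt (by positivity)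
        have h3 : c * γ * √(n : ℝ) ^ 2 + c / (4 * γ) * √(∑ j, v j ^ 2) ^ 2 -
            c * √n * √(∑ j, v j ^ 2) =
            c / (4 * γ) * (2 * γ * √n - √(∑ j, v j ^ 2)) ^ 2 := by
          field_simp
          ring
        rw [h1, h2] at h3
        have h4 : 0 ≤ c / (4 * γ) * (2 * γ * √n - √(∑ j, v j ^ 2)) ^ 2 := by positivity
        linarith
    _ = Real.exp (c * γ * n) * (√(1 - c / (2 * γ)))⁻¹ ^ n := by
        rw [integral_const_mul, hI]
    _ = Real.exp (n * (c * Isph c)) := by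
        rw [← Real.exp_log hpos, ← Real.exp_nat_mul, ← Real.exp_add, Real.log_inv,
          Real.log_sqrt (by linarith), Isph, ← hγ]
        congr 1
        field_simp
        ring

lemma integral_exp_neg_sum_max_sq {c γ : ℝ} (hc : 0 < c) (hγ : 0 < γ) (κ : ℝ) (m : ℕ) :
    ∫ y : Fin m → ℝ, Real.exp (-(c / (4 * γ)) * ∑ i, max (κ - y i) 0 ^ 2) ∂(stdGauss (Fin m)) =
      Iper1 c γ κ ^ m := by
  simp_rw [Finset.mul_sum, Real.exp_sum]
  rw [integral_prod_stdGauss fun t => Real.exp (-(c / (4 * γ)) * max (κ - t) 0 ^ 2),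
    integral_exp_neg_max_sq_gaussianReal hc hγ, Fintype.card_fin]

/-- The exponential of a negative norm as a maximum over `γ` of Gaussian exponentials, with `γ`
restricted to the grid `η, 2η, …, Kη`. -/
lemma exp_neg_mul_le_grid {c η s R : ℝ} (hc : 0 < c) (hη : 0 < η) (hs : 0 < s) (hR : 0 ≤ R)
    (K : ℕ) :
    Real.exp (-(c * s * R)) ≤ Real.exp (-(2 * c * s ^ 2 * (K * η))) +
      Real.exp (c * s ^ 2 * η) * ∑ j ∈ Finset.range K,
        Real.exp (-(c * s ^ 2 * ((j + 1) * η))) *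
          Real.exp (-(c / (4 * ((j + 1) * η))) * R ^ 2) := by
  obtain ⟨t, rfl⟩ : ∃ t, R = 2 * s * t := ⟨R / (2 * s), by field_simp⟩
  have ht : 0 ≤ t := by
    by_contra! h
    nlinarith
  rcases le_or_gt (K * η) t with h | h
  · refine le_add_of_le_of_nonneg (Real.exp_le_exp.2 ?_) (by positivity)
    have : c * s ^ 2 * (K * η) ≤ c * s ^ 2 * t := by gcongr
    nlinarith
  · set j := ⌊t / η⌋₊ with hj
    have hj1 : (j : ℝ) * η ≤ t := by
      rw [← le_div_iff₀ hη]; exact Nat.floor_le (by positivity)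
    have hj2 : t < (j + 1) * η := by
      rw [← div_lt_iff₀ hη]; exact Nat.lt_floor_add_one _
    have hjK : j ∈ Finset.range K := by
      rw [Finset.mem_range]
      have : (j : ℝ) < K := lt_of_mul_lt_mul_right (hj1.trans_lt h) hη.le
      exact_mod_cast this
    refine le_add_of_nonneg_of_le (by positivity) ?_
    have hle := Finset.single_le_sum (f := fun j : ℕ =>
        Real.exp (-(c * s ^ 2 * ((j + 1) * η))) *
          Real.exp (-(c / (4 * ((j + 1) * η))) * (2 * s * t) ^ 2))
        (fun _ _ => by positivity) hjK
    refine le_trans ?_ (mul_le_mul_of_nonneg_left hle (Real.exp_pos _).le)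
    rw [← Real.exp_add, ← Real.exp_add]
    refine Real.exp_le_exp.2 ?_
    set γ := ((j : ℝ) + 1) * η with hγ
    have hγ0 : 0 < γ := by positivity
    have h1 : t ^ 2 / γ ≤ t := by rw [div_le_iff₀ hγ0]; nlinarith
    have h2 : γ - η ≤ t := by rw [hγ]; linarith
    have h3 : c * s ^ 2 * (γ - η + t ^ 2 / γ) ≤ c * s ^ 2 * (2 * t) :=
      mul_le_mul_of_nonneg_left (by linarith) (by positivity)
    have h4 : -(c / (4 * γ)) * (2 * s * t) ^ 2 = -(c * s ^ 2 * (t ^ 2 / γ)) := by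
      field_simp; norm_num
    rw [h4]
    linarith

/-- Moment bound for the distance of a Gaussian vector to the orthant `{y | ∀ i, κ ≤ y i}`. -/
lemma integral_exp_neg_shortfall_le {c η : ℝ} (hc : 0 < c) (hη : 0 < η) (κ ε : ℝ) {n : ℕ}
    (hn : 0 < n) (m K : ℕ) :
    ∫ y, Real.exp (-(c * √n) * shortfall κ ε y) ∂(stdGauss (Fin m)) ≤
      Real.exp (-(2 * c * n * (K * η))) + Real.exp (c * n * η) * ∑ j ∈ Finset.range K,
        Real.exp (-(c * n * ((j + 1) * η))) * Iper1 c ((j + 1) * η) κ ^ m := by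
  have hs : 0 < √(n : ℝ) := Real.sqrt_pos.2 (by exact_mod_cast hn)
  have hs2 : √(n : ℝ) ^ 2 = n := Real.sq_sqrt (by positivity)
  have hint : ∀ j : ℕ, Integrable (fun y : Fin m → ℝ =>
      Real.exp (-(c / (4 * ((j + 1) * η))) * ∑ i, max (κ - y i) 0 ^ 2)) (stdGauss (Fin m)) :=
    fun j => Integrable.of_integral_ne_zero (by
      rw [integral_exp_neg_sum_max_sq hc (by positivity)]
      exact (pow_pos (Iper1_pos hc (by positivity) κ) m).ne')
  have hsum : Integrable (fun y : Fin m → ℝ => ∑ j ∈ Finset.range K,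
      Real.exp (-(c * n * ((j + 1) * η))) *
        Real.exp (-(c / (4 * ((j + 1) * η))) * ∑ i, max (κ - y i) 0 ^ 2)) (stdGauss (Fin m)) :=
    integrable_finsetSum _ fun j _ => (hint j).const_mul _
  calc _ ≤ ∫ y : Fin m → ℝ, (Real.exp (-(2 * c * n * (K * η))) +
        Real.exp (c * n * η) * ∑ j ∈ Finset.range K, Real.exp (-(c * n * ((j + 1) * η))) *
          Real.exp (-(c / (4 * ((j + 1) * η))) * ∑ i, max (κ - y i) 0 ^ 2))
        ∂(stdGauss (Fin m)) := by
        refine integral_mono_of_nonneg (ae_of_all _ fun y => (Real.exp_pos _).le)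
          ((integrable_const _).add (hsum.const_mul _)) (ae_of_all _ fun y => ?_)
        have h0 : (0 : ℝ) ≤ ∑ i, max (κ - y i) 0 ^ 2 := by positivity
        have h := exp_neg_mul_le_grid hc hη hs (Real.sqrt_nonneg (∑ i, max (κ - y i) 0 ^ 2)) K
        rw [Real.sq_sqrt h0, hs2] at h
        refine le_trans (Real.exp_le_exp.2 ?_) h
        have h1 : √(∑ i, max (κ - y i) 0 ^ 2) ≤ shortfall κ ε y :=
          Real.sqrt_le_sqrt (by linarith [sq_nonneg ε])
        have h2 : 0 < c * √(n : ℝ) := by positivity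
        nlinarith
    _ = _ := by
        rw [integral_add (integrable_const _) (hsum.const_mul _), integral_const, probReal_univ,
          one_smul, integral_const_mul, integral_finsetSum _ fun j _ => (hint j).const_mul _]
        congr 2
        refine Finset.sum_congr rfl fun j _ => ?_
        rw [integral_const_mul, integral_exp_neg_sum_max_sq hc (by positivity)]

end Moments

/-! ### Feasibility -/

section Feasibility

variable {m n : ℕ}

/-- The lifted Gordon bound for all unit vectors at once. -/
theorem measure_feasible_le (κ : ℝ) {ε c a : ℝ} (hε : 0 < ε) (hc : 0 < c) (ha : ε < a) :
    Real.exp (c ^ 2 / 2) * Real.exp (-c * a) * (stdGauss (Fin m × Fin n)).real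
        {H | ∃ x : Fin n → ℝ, ∑ j, x j ^ 2 = 1 ∧ ∀ i, κ ≤ mulVecEntries H x i} ≤
      (∫ v, Real.exp (c * √(∑ j, v j ^ 2)) ∂(stdGauss (Fin n))) *
        ∫ y, Real.exp (-c * shortfall κ ε y) ∂(stdGauss (Fin m)) := by
  set M := (∫ v, Real.exp (c * √(∑ j, v j ^ 2)) ∂(stdGauss (Fin n))) *
        ∫ y, Real.exp (-c * shortfall κ ε y) ∂(stdGauss (Fin m)) with hM
  have hM0 : 0 ≤ M := mul_nonneg (integral_nonneg fun _ => (Real.exp_pos _).le)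
    (integral_nonneg fun _ => (Real.exp_pos _).le)
  rcases isEmpty_or_nonempty {x : Fin n → ℝ // ∑ j, x j ^ 2 = 1} with hU | hU
  · have : {H : Fin m × Fin n → ℝ |
        ∃ x : Fin n → ℝ, ∑ j, x j ^ 2 = 1 ∧ ∀ i, κ ≤ mulVecEntries H x i} = ∅ := by
      ext H
      simp only [Set.mem_ofPred_eq, Set.mem_empty_iff_false, iff_false]
      rintro ⟨x, hx, -⟩
      exact hU.false ⟨x, hx⟩
    rw [this, measureReal_empty, mul_zero]
    exact hM0
  -- exhaust the sphere by the initial segments of a dense sequence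
  set d := TopologicalSpace.denseSeq {x : Fin n → ℝ // ∑ j, x j ^ 2 = 1} with hd
  set E : ℕ → Set (Fin m × Fin n → ℝ) := fun N =>
    {H | ∃ t : Fin N, shortfall κ ε (mulVecEntries H (d t).1) < a} with hE
  have hmono : Monotone E := by
    rintro N N' hN H ⟨t, ht⟩
    exact ⟨Fin.castLE hN t, ht⟩
  have hsub : {H : Fin m × Fin n → ℝ |
      ∃ x : Fin n → ℝ, ∑ j, x j ^ 2 = 1 ∧ ∀ i, κ ≤ mulVecEntries H x i} ⊆ ⋃ N, E N := by
    rintro H ⟨x, hx, hfe⟩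
    have hcont : Continuous fun x : {x : Fin n → ℝ // ∑ j, x j ^ 2 = 1} =>
        shortfall κ ε (mulVecEntries H x.1) :=
      (continuous_shortfall κ ε).comp (continuous_pi fun i => by
        simp only [mulVecEntries]
        exact continuous_finsetSum _ fun j _ =>
          continuous_const.mul ((continuous_apply j).comp continuous_subtype_val))
    obtain ⟨k, hk⟩ := (TopologicalSpace.denseRange_denseSeq
      {x : Fin n → ℝ // ∑ j, x j ^ 2 = 1}).exists_mem_open
      (hcont.isOpen_preimage _ isOpen_Iio) ⟨⟨x, hx⟩, by
        show shortfall κ ε (mulVecEntries H x) < a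
        rwa [shortfall_of_forall_le hε.le hfe]⟩
    exact Set.mem_iUnion.2 ⟨k + 1, ⟨k, Nat.lt_succ_self k⟩, hk⟩
  have hpos : 0 < Real.exp (c ^ 2 / 2) * Real.exp (-c * a) := by positivity
  have hN : ∀ N, stdGauss (Fin m × Fin n) (E N) ≤
      ENNReal.ofReal (M / (Real.exp (c ^ 2 / 2) * Real.exp (-c * a))) := fun N => by
    rw [← ofReal_measureReal]
    refine ENNReal.ofReal_le_ofReal ?_
    rw [le_div_iff₀' hpos]
    exact measure_exists_shortfall_lt_le κ hε hc a fun t : Fin N => (d t).2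
  rw [← le_div_iff₀' hpos, measureReal_def]
  refine ENNReal.toReal_le_of_le_ofReal (by positivity) ((measure_mono hsub).trans ?_)
  rw [hmono.measure_iUnion]
  exact iSup_le hN

lemma IsStdGaussianMatrix.map_eq {Ω : Type*} [MeasurableSpace Ω] {P : Measure Ω}
    [IsProbabilityMeasure P] {H : Ω → Matrix (Fin m) (Fin n) ℝ} (hH : IsStdGaussianMatrix H P) :
    P.map (fun ω (ij : Fin m × Fin n) => H ω ij.1 ij.2) = stdGauss (Fin m × Fin n) := by
  have h := (iIndepFun_iff_map_fun_eq_pi_map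
    (f := fun (ij : Fin m × Fin n) ω => H ω ij.1 ij.2)
    fun ij => (hH.hasLaw ij.1 ij.2).aemeasurable).1 hH.indep
  simp only [(hH.hasLaw _ _).map_eq] at h
  exact h

lemma IsStdGaussianMatrix.measure_feasible_le {Ω : Type*} [MeasurableSpace Ω] {P : Measure Ω}
    [IsProbabilityMeasure P] {H : Ω → Matrix (Fin m) (Fin n) ℝ} (hH : IsStdGaussianMatrix H P)
    (κ : ℝ) :
    P.real {ω | Feasible (H ω) κ} ≤ (stdGauss (Fin m × Fin n)).real
      {A | ∃ x : Fin n → ℝ, ∑ j, x j ^ 2 = 1 ∧ ∀ i, κ ≤ mulVecEntries A x i} := by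
  have hm : AEMeasurable (fun ω (ij : Fin m × Fin n) => H ω ij.1 ij.2) P :=
    aemeasurable_pi_lambda _ fun ij => (hH.hasLaw ij.1 ij.2).aemeasurable
  rw [← hH.map_eq]
  have := Measure.isProbabilityMeasure_map hm
  refine ENNReal.toReal_mono (measure_ne_top _ _) (le_trans (measure_mono ?_)
    (Measure.le_map_apply hm _))
  rintro ω ⟨x, hx, hfe⟩
  refine ⟨x.ofLp, ?_, hfe⟩
  rw [← EuclideanSpace.real_norm_sq_eq, hx, one_pow]

lemma exists_real_of_coe_add_lt_zero {u : ℝ} {I : EReal} (h : (u : EReal) + I < 0) :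
    ∃ V : ℝ, I ≤ V ∧ u + V < 0 := by
  induction I using EReal.rec with
  | bot => exact ⟨-u - 1, bot_le, by linarith⟩
  | coe V => exact ⟨V, le_rfl, by exact_mod_cast h⟩
  | top => simp at h

lemma le_of_Iper_le {c α κ V γ : ℝ} (hc : 0 < c) (hγ : 0 < γ) (h : Iper c α κ ≤ V) :
    α * Real.log (Iper1 c γ κ) ≤ c * (V + γ) := by
  have h1 : -γ + α / c * Real.log (Iper1 c γ κ) ≤ V := by
    have := (le_iSup (fun γ : Set.Ioi (0 : ℝ) =>
      ((-(γ : ℝ) + α / c * Real.log (Iper1 c γ κ) : ℝ) : EReal)) ⟨γ, hγ⟩).trans h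
    exact_mod_cast this
  have h2 : α * Real.log (Iper1 c γ κ) = c * (α / c * Real.log (Iper1 c γ κ)) := by field_simp
  rw [h2]
  exact mul_le_mul_of_nonneg_left (by linarith) hc.le

/-- Exponential bound on the probability of feasibility, from the values of `Iper1` on the grid. -/
lemma measure_feasible_le_exp {κ c V η : ℝ} (hc : 0 < c) (hη : 0 < η) {K : ℕ}
    (hK : -(2 * (K * η)) ≤ V) (hn : 0 < n)
    (hgrid : ∀ j ∈ Finset.range K,
      (m : ℝ) * Real.log (Iper1 c ((j + 1) * η) κ) ≤ n * (c * (V + (j + 1) * η) + c * η)) :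
    (stdGauss (Fin m × Fin n)).real
        {H | ∃ x : Fin n → ℝ, ∑ j, x j ^ 2 = 1 ∧ ∀ i, κ ≤ mulVecEntries H x i} ≤
      (K + 1) * Real.exp (n * (c * (-c / 2 + Isph c + V + 4 * η))) := by
  have hs : 0 < √(n : ℝ) := Real.sqrt_pos.2 (by exact_mod_cast hn)
  have hs2 : √(n : ℝ) * √n = n := Real.mul_self_sqrt (by positivity)
  have h1 := measure_feasible_le (m := m) (n := n) κ (ε := η * √n) (c := c * √n)
    (a := 2 * η * √n) (by positivity) (by positivity) (by nlinarith)
  have h2 := integral_exp_mul_norm_le hc (n := n)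
  have h3 := integral_exp_neg_shortfall_le hc hη κ (η * √n) hn m K
  have h4 : Real.exp (-(2 * c * n * (K * η))) + Real.exp (c * n * η) * ∑ j ∈ Finset.range K,
        Real.exp (-(c * n * ((j + 1) * η))) * Iper1 c ((j + 1) * η) κ ^ m ≤
      (K + 1) * Real.exp (n * (c * (V + 2 * η))) := by
    have hterm : ∀ j ∈ Finset.range K,
        Real.exp (-(c * n * ((j + 1) * η))) * Iper1 c ((j + 1) * η) κ ^ m ≤
          Real.exp (n * (c * (V + η))) := by
      intro j hj
      have hp := Iper1_pos hc (show 0 < ((j : ℝ) + 1) * η by positivity) κ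
      rw [← Real.exp_log hp, ← Real.exp_nat_mul, ← Real.exp_add]
      refine Real.exp_le_exp.2 ?_
      have := hgrid j hj
      linarith
    have hsum := Finset.sum_le_sum hterm
    rw [Finset.sum_const, Finset.card_range, nsmul_eq_mul] at hsum
    have hfirst : Real.exp (-(2 * c * n * (K * η))) ≤ Real.exp (n * (c * (V + 2 * η))) := by
      refine Real.exp_le_exp.2 ?_
      have h5 : (n : ℝ) * c * (-(2 * (K * η))) ≤ n * c * (V + 2 * η) :=
        mul_le_mul_of_nonneg_left (by linarith) (by positivity)
      linarith
    have hsecond := mul_le_mul_of_nonneg_left hsum (Real.exp_pos (c * n * η)).le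
    have h6 : Real.exp (c * n * η) * (K * Real.exp (n * (c * (V + η)))) =
        K * Real.exp (n * (c * (V + 2 * η))) := by
      rw [mul_left_comm, ← Real.exp_add]
      congr 2
      ring
    rw [h6] at hsecond
    linarith
  have h5 := h1.trans (mul_le_mul h2 (h3.trans h4)
    (integral_nonneg fun _ => (Real.exp_pos _).le) (Real.exp_pos _).le)
  have h6 : (c * √n) ^ 2 / 2 = n * (c ^ 2 / 2) := by
    rw [mul_pow, sq √(n : ℝ), hs2]; ring
  have h7 : -(c * √n) * (2 * η * √n) = -(n * (2 * c * η)) := by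
    rw [show -(c * √n) * (2 * η * √n) = -(√n * √n * (2 * c * η)) by ring, hs2]
  rw [h6, h7, ← Real.exp_add] at h5
  rw [← le_div_iff₀' (Real.exp_pos _)] at h5
  refine h5.trans_eq ?_
  rw [mul_left_comm, ← Real.exp_add, mul_div_assoc, ← Real.exp_sub]
  congr 2
  ring

end Feasibility

end NegPerceptron

/-- In the linear regime `m n / n → α`, if the lifted value is negative then the perceptron problem
with threshold `κ < 0` is infeasible with probability exponentially close to one. -/
theorem theorem4 (κ α : ℝ) (hκ : κ < 0) (hα : 0 < α)
    (m : ℕ → ℕ) (hm : Tendsto (fun n : ℕ => (m n : ℝ) / (n : ℝ)) atTop (𝓝 α))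
    (hlift : NegPerceptron.liftedValue α κ < 0) :
    ∃ δ : ℝ, 0 < δ ∧ ∀ᶠ n : ℕ in atTop,
      ∀ (Ω : Type*) [MeasurableSpace Ω] (P : Measure Ω) [IsProbabilityMeasure P]
        (H : Ω → Matrix (Fin (m n)) (Fin n) ℝ),
        NegPerceptron.IsStdGaussianMatrix H P →
          1 - Real.exp (-δ * n) ≤ P.real {ω | ¬ NegPerceptron.Feasible (H ω) κ} := by
  open NegPerceptron in
  obtain ⟨⟨c, hc⟩, hcI⟩ := iInf_lt_iff.1 hlift
  rw [Set.mem_Ioi] at hc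
  obtain ⟨V, hV, hneg⟩ := exists_real_of_coe_add_lt_zero hcI
  simp only at hV hneg
  -- Of the slack `8 * η`, the regularization costs `2 * η`, the grid and the ratio `m n / n` one `η`
  -- each; of the remaining `4 * η`, one half absorbs the number of grid points, the other gives `δ`.
  set η : ℝ := -(-c / 2 + Isph c + V) / 8 with hη_def
  have hη : 0 < η := by rw [hη_def]; linarith
  obtain ⟨K, hK⟩ := exists_nat_ge (-V / (2 * η))
  have hK' : -(2 * (K * η)) ≤ V := by
    rw [div_le_iff₀ (by positivity)] at hK
    linarith
  refine ⟨2 * (c * η), by positivity, ?_⟩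
  have hev1 : ∀ᶠ n : ℕ in atTop, ∀ j ∈ Finset.range K,
      (m n : ℝ) / n * Real.log (Iper1 c ((j + 1) * η) κ) ≤
        α * Real.log (Iper1 c ((j + 1) * η) κ) + c * η := by
    rw [Filter.eventually_all_finset]
    intro j _
    exact (hm.mul_const _).eventually (Iic_mem_nhds (by
      have : 0 < c * η := by positivity
      linarith))
  have hev2 : ∀ᶠ n : ℕ in atTop, ((K : ℝ) + 1) ≤ Real.exp (2 * (c * η) * n) := by
    have : Tendsto (fun n : ℕ => Real.exp (2 * (c * η) * n)) atTop atTop :=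
      Real.tendsto_exp_atTop.comp
        (tendsto_natCast_atTop_atTop.const_mul_atTop (by positivity))
    exact this.eventually_ge_atTop _
  filter_upwards [hev1, hev2, eventually_gt_atTop 0] with n h1 h2 hn Ω _ P _ H hH
  have hn' : (0 : ℝ) < n := by exact_mod_cast hn
  have hfeas := (hH.measure_feasible_le κ).trans
    (measure_feasible_le_exp (m := m n) (n := n) (κ := κ) (V := V) hc hη hK' hn fun j hj => by
      have h3 := h1 j hj
      have h4 := le_of_Iper_le hc (show 0 < ((j : ℝ) + 1) * η by positivity) hV
      calc (m n : ℝ) * Real.log (Iper1 c ((j + 1) * η) κ)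
          = n * ((m n : ℝ) / n * Real.log (Iper1 c ((j + 1) * η) κ)) := by field_simp
        _ ≤ _ := mul_le_mul_of_nonneg_left (by linarith) hn'.le)
  have h5 : -c / 2 + Isph c + V + 4 * η = -(4 * η) := by rw [hη_def]; ring
  have h6 : P.real {ω | Feasible (H ω) κ} ≤ Real.exp (-(2 * (c * η)) * n) := by
    refine hfeas.trans ((mul_le_mul_of_nonneg_right h2 (Real.exp_pos _).le).trans_eq ?_)
    rw [h5, ← Real.exp_add]
    congr 1
    ring
  -- subadditivity of the outer measure, so that measurability of the event is not needed
  have h7 : (1 : ℝ) ≤ P.real {ω | Feasible (H ω) κ} + P.real {ω | ¬ Feasible (H ω) κ} := by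
    have := measureReal_union_le (μ := P) {ω | Feasible (H ω) κ} {ω | ¬ Feasible (H ω) κ}
    have hun : {ω | Feasible (H ω) κ} ∪ {ω | ¬ Feasible (H ω) κ} = Set.univ := by
      ext ω; simp [em]
    rwa [hun, probReal_univ] at this
  linarith
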